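/- All manifolds are smooth ($C^\infty$), finite-dimensional, without boundary, Hausdorff and second countable. **Definitions.** A *smooth quasiloopoid* $G\rightrightarrows M$ is a manifold $G$ with an embedded submanifold $\varepsilon:M\hookrightarrow G$ of units, surjective submersions $\alpha,\beta:G\to M$ that are the identity on $M$, and a product $gh$ defined exactly when $\beta(g)=\alpha(h)$ and smooth on the closed embedded submanifold $G^{(2)}=\{(g,h):\beta(g)=\alpha(h)\}$ of $G\times G$, such that $g\,\beta(g)=g$ and $\alpha(h)\,h=h$ for all $g,h$, and such that the translations $l_g:\alpha^{-1}(\beta(g))\to G$, $l_g(h)=gh$, and $r_h:\beta^{-1}(\alpha(h))\to G$, $r_h(g)=gh$, are injective immersions. It is a *smooth loopoid* if moreover (i) unities associativity holds: whenever one of $x,y,z$ is a unit, $(xy)z$ is defined if and only if $x(yz)$ is, and then they are equal; and (ii) the translations are diffeomorphisms between fibres, $l_g:\alpha^{-1}(\beta(g))\to\alpha^{-1}(\alpha(g))$ and $r_h:\beta^{-1}(\alpha(h))\to\beta^{-1}(\beta(h))$. Let $AG=TG|_M/TM\to M$ be the normal bundle. For $X\in A_aG$ let $\bar X^\alpha$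 and $\bar X^\beta$ be its unique representatives in $T_aG$ that are tangent to the $\alpha$-fibre and to the $\beta$-fibre, respectively. For a smooth section $X$ of $AG$ define the left and right prolongations, vector fields on $G$, by $$\overleftarrow{X}(g)=T l_g\big(\bar X^\alpha(\beta(g))\big),\qquad \overrightarrow{X}(g)=T r_g\big(\bar X^\beta(\alpha(g))\big),$$ let $[X,Y]_l(a)$ and $[X,Y]_r(a)$, for $a\in M$, be the classes in $A_aG$ of $[\overleftarrow X,\overleftarrow Y](a)$ and $[\overrightarrow X,\overrightarrow Y](a)$, and put $\rho_l(X)=T\beta(\bar X^\alpha)$, $\rho_r(X)=T\alpha(\bar X^\beta)$. A *skew algebroid* structure on a vector bundle $E\to M$ is a skew-symmetric $\mathbb R$-bilinear bracket $[\cdot,\cdot]$ on its smooth sections together with a vector bundle morphism $\rho:E\to TM$ over $\mathrm{id}_M$ (the anchor) such that $[X,fY]=f[X,Y]+\rho(X)(f)\,Y$ for all $f\in C^\infty(M)$ and all sections $X,Y$. It is an *almost Lie algebroid* if in addition $\rho([X,Y])=[\rho(X),\rho(Y)]$ for all sections $X,Y$, where the right-hand side is the Lie bracket of vector fields. **Theorem.**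 Let $G\rightrightarrows M$ be a smooth loopoid. Then the left and right prolongations of smooth sections of $AG$ are smooth vector fields on $G$, both $(AG,[\cdot,\cdot]_l,\rho_l)$ and $(AG,[\cdot,\cdot]_r,\rho_r)$ are almost Lie algebroids, and their anchors are opposite: $\rho_r=-\rho_l$. -/

import Mathlib

open Set Manifold Bundle VectorField
open scoped Manifold ContDiff Topology Bundle

/-- A smooth quasiloopoid `G ⇉ M`.  The manifold of units `M` is embedded in `G` by `ε`.
The product `mul g h` is meaningful only for composable pairs, i.e. if `β g = α h`; its values at
other pairs are never used.  Smoothness of the multiplication is smoothness on the (automatically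
closed and embedded) submanifold `G⁽²⁾ = {(g, h) | β g = α h}` of `G × G`.
For `h` in the fibre `α⁻¹(β g)` and `v` tangent to this fibre (i.e. `Tα v = 0`),
the vector `mfderivWithin _ _ (mul g) (α⁻¹(β g)) h v` is the value of the tangent map `T l_g`
at `v`; derivatives within a submanifold are unambiguous on vectors tangent to it. -/
structure SmoothQuasiloopoid (EG EM G M : Type*)
    [NormedAddCommGroup EG] [NormedSpace ℝ EG] [NormedAddCommGroup EM] [NormedSpace ℝ EM]
    [TopologicalSpace G] [ChartedSpace EG G] [TopologicalSpace M] [ChartedSpace EM M] where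
  /-- the target map -/
  α : G → M
  /-- the source map -/
  β : G → M
  /-- the embedding of the units -/
  ε : M → G
  /-- the partial multiplication -/
  mul : G → G → G
  isSubmersion_α : IsSubmersion 𝓘(ℝ, EG) 𝓘(ℝ, EM) ∞ α
  isSubmersion_β : IsSubmersion 𝓘(ℝ, EG) 𝓘(ℝ, EM) ∞ β
  surjective_α : Function.Surjective α
  surjective_β : Function.Surjective β
  isSmoothEmbedding_ε : IsSmoothEmbedding 𝓘(ℝ, EM) 𝓘(ℝ, EG) ∞ ε
  α_ε : ∀ x, α (ε x) = x
  β_ε : ∀ x, β (ε x) = x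
  mul_unit : ∀ g, mul g (ε (β g)) = g
  unit_mul : ∀ h, mul (ε (α h)) h = h
  contMDiffOn_mul : ContMDiffOn (𝓘(ℝ, EG).prod 𝓘(ℝ, EG)) 𝓘(ℝ, EG) ∞
    (fun p : G × G => mul p.1 p.2) {p | β p.1 = α p.2}
  injOn_left : ∀ g, InjOn (fun h => mul g h) {h | α h = β g}
  injOn_right : ∀ h, InjOn (fun g => mul g h) {g | β g = α h}
  immersion_left : ∀ g h, α h = β g → ∀ v : TangentSpace 𝓘(ℝ, EG) h,
    mfderiv 𝓘(ℝ, EG) 𝓘(ℝ, EM) α h v = 0 →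
    mfderivWithin 𝓘(ℝ, EG) 𝓘(ℝ, EG) (fun h => mul g h) {h | α h = β g} h v = 0 → v = 0
  immersion_right : ∀ g h, β g = α h → ∀ v : TangentSpace 𝓘(ℝ, EG) g,
    mfderiv 𝓘(ℝ, EG) 𝓘(ℝ, EM) β g v = 0 →
    mfderivWithin 𝓘(ℝ, EG) 𝓘(ℝ, EG) (fun g => mul g h) {g | β g = α h} g v = 0 → v = 0

namespace SmoothQuasiloopoid

variable {EG EM G M : Type*}
  [NormedAddCommGroup EG] [NormedSpace ℝ EG] [NormedAddCommGroup EM] [NormedSpace ℝ EM]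
  [TopologicalSpace G] [ChartedSpace EG G] [TopologicalSpace M] [ChartedSpace EM M]

/-- Unities associativity: if one of `x`, `y`, `z` is a unit and one of `(xy)z`, `x(yz)` makes
sense, then so does the other one and they are equal. -/
def UnitiesAssociative (L : SmoothQuasiloopoid EG EM G M) : Prop :=
  ∀ x y z : G, (x ∈ range L.ε ∨ y ∈ range L.ε ∨ z ∈ range L.ε) →
    ((L.β x = L.α y ∧ L.β (L.mul x y) = L.α z) ↔
      (L.β y = L.α z ∧ L.β x = L.α (L.mul y z))) ∧
    ((L.β x = L.α y ∧ L.β (L.mul x y) = L.α z) →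
      L.mul (L.mul x y) z = L.mul x (L.mul y z))

end SmoothQuasiloopoid

/-- `f` restricts to a diffeomorphism between the embedded submanifolds `S` and `T` of `G`. -/
def IsDiffeoBetween {EG G : Type*} [NormedAddCommGroup EG] [NormedSpace ℝ EG]
    [TopologicalSpace G] [ChartedSpace EG G] (f : G → G) (S T : Set G) : Prop :=
  ∃ k : G → G, MapsTo f S T ∧ MapsTo k T S ∧ InvOn k f S T ∧
    ContMDiffOn 𝓘(ℝ, EG) 𝓘(ℝ, EG) ∞ f S ∧ ContMDiffOn 𝓘(ℝ, EG) 𝓘(ℝ, EG) ∞ k T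

namespace SmoothQuasiloopoid

variable {EG EM G M : Type*}
  [NormedAddCommGroup EG] [NormedSpace ℝ EG] [NormedAddCommGroup EM] [NormedSpace ℝ EM]
  [TopologicalSpace G] [ChartedSpace EG G] [TopologicalSpace M] [ChartedSpace EM M]

/-- A quasiloopoid is a loopoid if it satisfies unities associativity and the translations are
diffeomorphisms `α⁻¹(β g) → α⁻¹(α g)` and `β⁻¹(α h) → β⁻¹(β h)` between the fibres. -/
structure IsLoopoid (L : SmoothQuasiloopoid EG EM G M) : Prop where
  unitiesAssociative : L.UnitiesAssociative
  left_diffeo : ∀ g, IsDiffeoBetween (EG := EG) (fun h => L.mul g h)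
    {h | L.α h = L.β g} {h | L.α h = L.α g}
  right_diffeo : ∀ h, IsDiffeoBetween (EG := EG) (fun g => L.mul g h)
    {g | L.β g = L.α h} {g | L.β g = L.β h}

/-- `Tα : T_{ε x} G → T_x M`. -/
noncomputable def Tα (L : SmoothQuasiloopoid EG EM G M) (x : M) :
    TangentSpace 𝓘(ℝ, EG) (L.ε x) →L[ℝ] TangentSpace 𝓘(ℝ, EM) x :=
  mfderiv 𝓘(ℝ, EG) 𝓘(ℝ, EM) L.α (L.ε x)

/-- `Tβ : T_{ε x} G → T_x M`. -/
noncomputable def Tβ (L : SmoothQuasiloopoid EG EM G M) (x : M) :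
    TangentSpace 𝓘(ℝ, EG) (L.ε x) →L[ℝ] TangentSpace 𝓘(ℝ, EM) x :=
  mfderiv 𝓘(ℝ, EG) 𝓘(ℝ, EM) L.β (L.ε x)

/-- `Tε : T_x M → T_{ε x} G`. -/
noncomputable def Tε (L : SmoothQuasiloopoid EG EM G M) (x : M) :
    TangentSpace 𝓘(ℝ, EM) x →L[ℝ] TangentSpace 𝓘(ℝ, EG) (L.ε x) :=
  mfderiv 𝓘(ℝ, EM) 𝓘(ℝ, EG) L.ε x

/-- The fibre at `x` of the normal bundle `AG = TG|_M / TM`. -/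
def Normal (L : SmoothQuasiloopoid EG EM G M) (x : M) : Type _ :=
  TangentSpace 𝓘(ℝ, EG) (L.ε x) ⧸ (L.Tε x).range

variable (L : SmoothQuasiloopoid EG EM G M)

noncomputable instance (x : M) : AddCommGroup (L.Normal x) :=
  inferInstanceAs (AddCommGroup (TangentSpace 𝓘(ℝ, EG) (L.ε x) ⧸ (L.Tε x).range))
noncomputable instance (x : M) : Module ℝ (L.Normal x) :=
  inferInstanceAs (Module ℝ (TangentSpace 𝓘(ℝ, EG) (L.ε x) ⧸ (L.Tε x).range))
instance (x : M) : TopologicalSpace (L.Normal x) :=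
  inferInstanceAs (TopologicalSpace (TangentSpace 𝓘(ℝ, EG) (L.ε x) ⧸ (L.Tε x).range))
instance (x : M) : IsTopologicalAddGroup (L.Normal x) :=
  inferInstanceAs (IsTopologicalAddGroup (TangentSpace 𝓘(ℝ, EG) (L.ε x) ⧸ (L.Tε x).range))
instance (x : M) : ContinuousSMul ℝ (L.Normal x) :=
  inferInstanceAs (ContinuousSMul ℝ (TangentSpace 𝓘(ℝ, EG) (L.ε x) ⧸ (L.Tε x).range))

/-- The class in the normal bundle of a vector tangent to `G` at a unit. -/
noncomputable def normalMk (x : M) : TangentSpace 𝓘(ℝ, EG) (L.ε x) →ₗ[ℝ] L.Normal x :=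
  (L.Tε x).range.mkQ

theorem Tα_Tε (x : M) (v : TangentSpace 𝓘(ℝ, EM) x) : L.Tα x (L.Tε x v) = v := by
  have hα := (L.isSubmersion_α.contMDiff).mdifferentiable (by simp) (L.ε x)
  have hε := (L.isSmoothEmbedding_ε.isImmersion.contMDiff).mdifferentiable (by simp) x
  have h := mfderiv_comp x hα hε
  have hid : L.α ∘ L.ε = id := funext L.α_ε
  rw [hid, mfderiv_id] at h
  exact (DFunLike.congr_fun h v).symm

theorem Tβ_Tε (x : M) (v : TangentSpace 𝓘(ℝ, EM) x) : L.Tβ x (L.Tε x v) = v := by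
  have hα := (L.isSubmersion_β.contMDiff).mdifferentiable (by simp) (L.ε x)
  have hε := (L.isSmoothEmbedding_ε.isImmersion.contMDiff).mdifferentiable (by simp) x
  have h := mfderiv_comp x hα hε
  have hid : L.β ∘ L.ε = id := funext L.β_ε
  rw [hid, mfderiv_id] at h
  exact (DFunLike.congr_fun h v).symm

/-- The projection `v ↦ v - Tε (Tα v)` of `T_{ε x} G` onto the vectors tangent to the `α`-fibre. -/
noncomputable def projα (x : M) :
    TangentSpace 𝓘(ℝ, EG) (L.ε x) →L[ℝ] TangentSpace 𝓘(ℝ, EG) (L.ε x) :=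
  ContinuousLinearMap.id ℝ _ - (L.Tε x).comp (L.Tα x)

/-- The projection `v ↦ v - Tε (Tβ v)` of `T_{ε x} G` onto the vectors tangent to the `β`-fibre. -/
noncomputable def projβ (x : M) :
    TangentSpace 𝓘(ℝ, EG) (L.ε x) →L[ℝ] TangentSpace 𝓘(ℝ, EG) (L.ε x) :=
  ContinuousLinearMap.id ℝ _ - (L.Tε x).comp (L.Tβ x)

/-- The canonical representative `X̄^α`, tangent to the `α`-fibre, of a normal vector `X`. -/
noncomputable def repα (x : M) : L.Normal x →ₗ[ℝ] TangentSpace 𝓘(ℝ, EG) (L.ε x) :=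
  (L.Tε x).range.liftQ (L.projα x).toLinearMap (by
    rintro _ ⟨v, rfl⟩
    simp [projα, L.Tα_Tε])

/-- The canonical representative `X̄^β`, tangent to the `β`-fibre, of a normal vector `X`. -/
noncomputable def repβ (x : M) : L.Normal x →ₗ[ℝ] TangentSpace 𝓘(ℝ, EG) (L.ε x) :=
  (L.Tε x).range.liftQ (L.projβ x).toLinearMap (by
    rintro _ ⟨v, rfl⟩
    simp [projβ, L.Tβ_Tε])

theorem normalMk_repα (x : M) (a : L.Normal x) : L.normalMk x (L.repα x a) = a := by
  obtain ⟨v, rfl⟩ := (L.Tε x).range.mkQ_surjective a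
  change (L.Tε x).range.mkQ (v - L.Tε x (L.Tα x v)) = _
  rw [map_sub, sub_eq_self]
  exact (Submodule.Quotient.mk_eq_zero _).2 ⟨_, rfl⟩

theorem normalMk_repβ (x : M) (a : L.Normal x) : L.normalMk x (L.repβ x a) = a := by
  obtain ⟨v, rfl⟩ := (L.Tε x).range.mkQ_surjective a
  change (L.Tε x).range.mkQ (v - L.Tε x (L.Tβ x v)) = _
  rw [map_sub, sub_eq_self]
  exact (Submodule.Quotient.mk_eq_zero _).2 ⟨_, rfl⟩

theorem Tα_repα (x : M) (a : L.Normal x) : L.Tα x (L.repα x a) = 0 := by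
  obtain ⟨v, rfl⟩ := (L.Tε x).range.mkQ_surjective a
  change L.Tα x (v - L.Tε x (L.Tα x v)) = 0
  rw [map_sub, Tα_Tε, sub_self]

theorem Tβ_repβ (x : M) (a : L.Normal x) : L.Tβ x (L.repβ x a) = 0 := by
  obtain ⟨v, rfl⟩ := (L.Tε x).range.mkQ_surjective a
  change L.Tβ x (v - L.Tε x (L.Tβ x v)) = 0
  rw [map_sub, Tβ_Tε, sub_self]

end SmoothQuasiloopoid

/-- Operator-valued maps on a manifold are smooth if all their evaluations are. -/
theorem contMDiffOn_clm_of_apply {EM M : Type*} [NormedAddCommGroup EM] [NormedSpace ℝ EM]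
    [TopologicalSpace M] [ChartedSpace EM M] {V W : Type*} [NormedAddCommGroup V]
    [NormedSpace ℝ V] [FiniteDimensional ℝ V] [NormedAddCommGroup W] [NormedSpace ℝ W]
    {f : M → V →L[ℝ] W} {s : Set M}
    (h : ∀ y, ContMDiffOn 𝓘(ℝ, EM) 𝓘(ℝ, W) ∞ (fun x => f x y) s) :
    ContMDiffOn 𝓘(ℝ, EM) 𝓘(ℝ, V →L[ℝ] W) ∞ f s := by
  let d := Module.finrank ℝ V
  have hd : d = Module.finrank ℝ (Fin d → ℝ) := (Module.finrank_fin_fun ℝ).symm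
  let e₁ := ContinuousLinearEquiv.ofFinrankEq hd
  let e₂ := (e₁.arrowCongr (1 : W ≃L[ℝ] W)).trans (ContinuousLinearEquiv.piRing (Fin d))
  rw [← Function.id_comp f, ← e₂.symm_comp_self]
  exact e₂.symm.contDiff.contMDiff.comp_contMDiffOn
    (contMDiffOn_pi_space.2 fun i => h _)

/-- The model fibre of the normal bundle. -/
abbrev NormalModel (EG EM : Type*) [NormedAddCommGroup EG] [NormedSpace ℝ EG]
    [NormedAddCommGroup EM] [NormedSpace ℝ EM] : Type :=
  EuclideanSpace ℝ (Fin (Module.finrank ℝ EG - Module.finrank ℝ EM))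

namespace SmoothQuasiloopoid

variable {EG EM G M : Type*}
  [NormedAddCommGroup EG] [NormedSpace ℝ EG] [NormedAddCommGroup EM] [NormedSpace ℝ EM]
  [TopologicalSpace G] [ChartedSpace EG G] [TopologicalSpace M] [ChartedSpace EM M]
  (L : SmoothQuasiloopoid EG EM G M)

theorem contMDiff_ε : ContMDiff 𝓘(ℝ, EM) 𝓘(ℝ, EG) ∞ L.ε :=
  L.isSmoothEmbedding_ε.isImmersion.contMDiff

theorem repα_normalMk (x : M) (v : TangentSpace 𝓘(ℝ, EG) (L.ε x)) :
    L.repα x (L.normalMk x v) = L.projα x v := rfl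

theorem injective_Tε (x : M) : Function.Injective (L.Tε x) :=
  (show Function.LeftInverse (L.Tα x) (L.Tε x) from L.Tα_Tε x).injective

theorem finrank_range_Tε (x : M) :
    Module.finrank ℝ (L.Tε x).range = Module.finrank ℝ EM :=
  LinearMap.finrank_range_of_inj (L.injective_Tε x)

theorem projα_idem (x : M) (v : TangentSpace 𝓘(ℝ, EG) (L.ε x)) :
    L.projα x (L.projα x v) = L.projα x v := by
  simp [projα, L.Tα_Tε]

theorem ker_projα (x : M) : (L.projα x).ker = (L.Tε x).range := by
  ext v
  constructor
  · intro h
    have h' : v - L.Tε x (L.Tα x v) = 0 := h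
    exact ⟨L.Tα x v, (sub_eq_zero.1 h').symm⟩
  · rintro ⟨w, rfl⟩
    simp [projα, L.Tα_Tε]

section FiniteDim
variable [FiniteDimensional ℝ EG]

instance (x : M) : FiniteDimensional ℝ (TangentSpace 𝓘(ℝ, EG) (L.ε x)) :=
  inferInstanceAs (FiniteDimensional ℝ EG)

instance (x : M) : FiniteDimensional ℝ (L.Normal x) :=
  inferInstanceAs (FiniteDimensional ℝ (TangentSpace 𝓘(ℝ, EG) (L.ε x) ⧸ (L.Tε x).range))

theorem finrank_normal (x : M) :
    Module.finrank ℝ (L.Normal x) = Module.finrank ℝ (NormalModel EG EM) := by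
  have h1 := (L.Tε x).range.finrank_quotient_add_finrank
  have h2 := L.finrank_range_Tε x
  have h3 : Module.finrank ℝ (TangentSpace 𝓘(ℝ, EG) (L.ε x)) = Module.finrank ℝ EG := rfl
  have h4 : Module.finrank ℝ (L.Normal x) =
    Module.finrank ℝ (TangentSpace 𝓘(ℝ, EG) (L.ε x) ⧸ (L.Tε x).range) := rfl
  rw [finrank_euclideanSpace_fin]
  omega

theorem finrank_range_projα (x : M) :
    Module.finrank ℝ (L.projα x).range = Module.finrank ℝ (NormalModel EG EM) := by
  have h1 := LinearMap.finrank_range_add_finrank_ker (L.projα x).toLinearMap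
  have h2 := L.finrank_range_Tε x
  have h3 : Module.finrank ℝ (TangentSpace 𝓘(ℝ, EG) (L.ε x)) = Module.finrank ℝ EG := rfl
  have h4 := L.ker_projα x
  rw [h4] at h1
  rw [finrank_euclideanSpace_fin]
  omega

instance (x : M) : T2Space (L.Normal x) := by
  have : T2Space (TangentSpace 𝓘(ℝ, EG) (L.ε x)) := inferInstanceAs (T2Space EG)
  have : IsClosed ((L.Tε x).range : Set (TangentSpace 𝓘(ℝ, EG) (L.ε x))) :=
    Submodule.closed_of_finiteDimensional _
  have : T3Space (TangentSpace 𝓘(ℝ, EG) (L.ε x) ⧸ (L.Tε x).range) := inferInstance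
  exact inferInstanceAs (T2Space (TangentSpace 𝓘(ℝ, EG) (L.ε x) ⧸ (L.Tε x).range))

variable [IsManifold 𝓘(ℝ, EG) ∞ G]

/-- The trivialization of `TG` around `ε x₀`. -/
noncomputable abbrev triv (x₀ : M) :
    Trivialization EG (π EG (TangentSpace 𝓘(ℝ, EG) : G → Type _)) :=
  trivializationAt EG (TangentSpace 𝓘(ℝ, EG)) (L.ε x₀)

/-- The projection `projα` in coordinates around `ε x₀` on the source, `ε x₁` on the target. -/
noncomputable def projCoord (x₀ x₁ x : M) : EG →L[ℝ] EG :=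
  ((L.triv x₁).continuousLinearMapAt ℝ (L.ε x)).comp
    ((L.projα x).comp ((L.triv x₀).symmL ℝ (L.ε x)))

theorem exists_frame (x₀ : M) :
    ∃ cs : (EG →L[ℝ] NormalModel EG EM) × (NormalModel EG EM →L[ℝ] EG),
      cs.1.comp ((L.projCoord x₀ x₀ x₀).comp cs.2) = 1 := by
  have hmem : L.ε x₀ ∈ (L.triv x₀).baseSet := FiberBundle.mem_baseSet_trivializationAt' _
  let e : (L.projα x₀).range ≃ₗ[ℝ] NormalModel EG EM :=
    LinearEquiv.ofFinrankEq _ _ (L.finrank_range_projα x₀)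
  let s : NormalModel EG EM →ₗ[ℝ] EG :=
    ((L.triv x₀).continuousLinearMapAt ℝ (L.ε x₀)).toLinearMap ∘ₗ
      (L.projα x₀).range.subtype ∘ₗ e.symm.toLinearMap
  let c : EG →ₗ[ℝ] NormalModel EG EM :=
    e.toLinearMap ∘ₗ (L.projα x₀).toLinearMap.rangeRestrict ∘ₗ
      ((L.triv x₀).symmL ℝ (L.ε x₀)).toLinearMap
  refine ⟨⟨LinearMap.toContinuousLinearMap c, LinearMap.toContinuousLinearMap s⟩, ?_⟩
  ext1 w
  obtain ⟨v, hv⟩ := (e.symm w).2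
  have hs : s w = (L.triv x₀).continuousLinearMapAt ℝ (L.ε x₀) (L.projα x₀ v) := by
    have : L.projα x₀ v = (e.symm w : TangentSpace 𝓘(ℝ, EG) (L.ε x₀)) := hv
    rw [this]
    rfl
  have hp : L.projCoord x₀ x₀ x₀ (s w) = s w := by
    rw [hs]
    change (L.triv x₀).continuousLinearMapAt ℝ (L.ε x₀) (L.projα x₀
      ((L.triv x₀).symmL ℝ (L.ε x₀) ((L.triv x₀).continuousLinearMapAt ℝ (L.ε x₀) _))) = _
    rw [Trivialization.symmL_continuousLinearMapAt _ hmem, L.projα_idem]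
  change c (L.projCoord x₀ x₀ x₀ (s w)) = w
  rw [hp, hs]
  change e ((L.projα x₀).toLinearMap.rangeRestrict
    ((L.triv x₀).symmL ℝ (L.ε x₀) ((L.triv x₀).continuousLinearMapAt ℝ (L.ε x₀) _))) = w
  rw [Trivialization.symmL_continuousLinearMapAt _ hmem]
  rw [← e.eq_symm_apply]
  apply Subtype.ext
  change L.projα x₀ (L.projα x₀ v) = _
  rw [L.projα_idem]
  exact hv

/-- Linear coordinates `EG → ℝʳ` used to trivialize the normal bundle near `x₀`. -/
noncomputable def frameC (x₀ : M) : EG →L[ℝ] NormalModel EG EM := (L.exists_frame x₀).choose.1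

/-- A right inverse of `frameC`, up to the projection at `x₀`. -/
noncomputable def frameS (x₀ : M) : NormalModel EG EM →L[ℝ] EG := (L.exists_frame x₀).choose.2

/-- The matrix of the projection at `x` with respect to the coordinates chosen at `x₀`. -/
noncomputable def frameD (x₀ x : M) : NormalModel EG EM →L[ℝ] NormalModel EG EM :=
  (L.frameC x₀).comp ((L.projCoord x₀ x₀ x).comp (L.frameS x₀))

/-- The open set over which the normal bundle is trivialized. -/
def normalBase (x₀ : M) : Set M :=
  {x | L.ε x ∈ (L.triv x₀).baseSet ∧ IsUnit (L.frameD x₀ x)}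

theorem mem_normalBase (x₀ : M) : x₀ ∈ L.normalBase x₀ := by
  refine ⟨FiberBundle.mem_baseSet_trivializationAt' _, ?_⟩
  have : L.frameD x₀ x₀ = 1 := (L.exists_frame x₀).choose_spec
  rw [this]
  exact isUnit_one

/-- Coordinates on the fibres of the normal bundle near `x₀`. -/
noncomputable def normalCoord (x₀ x : M) : L.Normal x →ₗ[ℝ] NormalModel EG EM :=
  (L.frameC x₀).toLinearMap ∘ₗ
    ((L.triv x₀).continuousLinearMapAt ℝ (L.ε x)).toLinearMap ∘ₗ L.repα x

/-- The inverse of `normalCoord`. -/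
noncomputable def normalCoordSymm (x₀ x : M) (w : NormalModel EG EM) : L.Normal x :=
  L.normalMk x ((L.triv x₀).symmL ℝ (L.ε x) (L.frameS x₀ (Ring.inverse (L.frameD x₀ x) w)))

theorem normalCoord_normalCoordSymm (x₀ x : M) (h : x ∈ L.normalBase x₀)
    (w : NormalModel EG EM) : L.normalCoord x₀ x (L.normalCoordSymm x₀ x w) = w := by
  change (L.frameD x₀ x * Ring.inverse (L.frameD x₀ x)) w = w
  rw [Ring.mul_inverse_cancel _ h.2]
  rfl

theorem bijective_normalCoord (x₀ x : M) (h : x ∈ L.normalBase x₀) :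
    Function.Bijective (L.normalCoord x₀ x) := by
  have hs : Function.Surjective (L.normalCoord x₀ x) :=
    fun w => ⟨_, L.normalCoord_normalCoordSymm x₀ x h w⟩
  exact ⟨(LinearMap.injective_iff_surjective_of_finrank_eq_finrank (L.finrank_normal x)).2 hs, hs⟩

theorem normalCoordSymm_normalCoord (x₀ x : M) (h : x ∈ L.normalBase x₀) (a : L.Normal x) :
    L.normalCoordSymm x₀ x (L.normalCoord x₀ x a) = a :=
  (L.bijective_normalCoord x₀ x h).1 (L.normalCoord_normalCoordSymm x₀ x h _)

section Smooth
variable [IsManifold 𝓘(ℝ, EM) ∞ M]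

theorem contMDiffOn_projCoord (x₀ x₁ : M) :
    ContMDiffOn 𝓘(ℝ, EM) 𝓘(ℝ, EG →L[ℝ] EG) ∞ (L.projCoord x₀ x₁)
      (L.ε ⁻¹' ((L.triv x₀).baseSet ∩ (L.triv x₁).baseSet)) := by
  apply contMDiffOn_clm_of_apply
  intro w
  set S := L.ε ⁻¹' ((L.triv x₀).baseSet ∩ (L.triv x₁).baseSet) with hS
  -- the constant vector `w` as a field along `ε`
  have h0 : ContMDiffOn 𝓘(ℝ, EM) (𝓘(ℝ, EG).prod 𝓘(ℝ, EG)) ∞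
      (fun x => (L.triv x₀).toOpenPartialHomeomorph.symm (L.ε x, w)) S := by
    refine (L.triv x₀).contMDiffOn_symm.comp
      (L.contMDiff_ε.contMDiffOn.prodMk contMDiffOn_const) ?_
    intro x hx
    exact (L.triv x₀).mem_target.2 hx.1
  have h1 : ContMDiffOn 𝓘(ℝ, EM) (𝓘(ℝ, EG).prod 𝓘(ℝ, EG)) ∞
      (fun x => tangentMap 𝓘(ℝ, EM) 𝓘(ℝ, EG) L.ε (tangentMap 𝓘(ℝ, EG) 𝓘(ℝ, EM) L.α
        ((L.triv x₀).toOpenPartialHomeomorph.symm (L.ε x, w)))) S :=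
    (L.contMDiff_ε.contMDiff_tangentMap (m := ∞) (by simp)).comp_contMDiffOn
      ((L.isSubmersion_α.contMDiff.contMDiff_tangentMap (m := ∞) (by simp)).comp_contMDiffOn h0)
  have e0 : ∀ x ∈ S, (L.triv x₀).toOpenPartialHomeomorph.symm (L.ε x, w) =
      ⟨L.ε x, (L.triv x₀).symmL ℝ (L.ε x) w⟩ := by
    intro x hx
    rw [Trivialization.symmL_apply _ hx.1]
    exact ((L.triv x₀).mk_symm hx.1 w).symm
  have e1 : ∀ x ∈ S, tangentMap 𝓘(ℝ, EM) 𝓘(ℝ, EG) L.ε (tangentMap 𝓘(ℝ, EG) 𝓘(ℝ, EM) L.α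
        ((L.triv x₀).toOpenPartialHomeomorph.symm (L.ε x, w))) =
      ⟨L.ε x, L.Tε x (L.Tα x ((L.triv x₀).symmL ℝ (L.ε x) w))⟩ := by
    intro x hx
    rw [e0 x hx]
    have key : ∀ (y : M) (hy : y = x) (u : EM),
        (⟨L.ε y, mfderiv 𝓘(ℝ, EM) 𝓘(ℝ, EG) L.ε y u⟩ : TangentBundle 𝓘(ℝ, EG) G) =
        ⟨L.ε x, mfderiv 𝓘(ℝ, EM) 𝓘(ℝ, EG) L.ε x u⟩ := by
      rintro y rfl u
      rfl
    exact key _ (L.α_ε x) _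
  have h0' := (((L.triv x₁).contMDiffOn_iff (IM := 𝓘(ℝ, EM)) (s := S)
    (f := fun x => (L.triv x₀).toOpenPartialHomeomorph.symm (L.ε x, w)) (by
      intro x hx
      dsimp only
      rw [e0 x hx]
      exact (L.triv x₁).mem_source.2 hx.2)).1 h0).2
  have h1' := (((L.triv x₁).contMDiffOn_iff (IM := 𝓘(ℝ, EM)) (s := S)
    (f := fun x => tangentMap 𝓘(ℝ, EM) 𝓘(ℝ, EG) L.ε (tangentMap 𝓘(ℝ, EG) 𝓘(ℝ, EM) L.α
        ((L.triv x₀).toOpenPartialHomeomorph.symm (L.ε x, w)))) (by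
      intro x hx
      dsimp only
      rw [e1 x hx]
      exact (L.triv x₁).mem_source.2 hx.2)).1 h1).2
  refine (h0'.sub h1').congr ?_
  intro x hx
  rw [e1 x hx, e0 x hx, ← Trivialization.continuousLinearMapAt_apply_of_mem (R := ℝ) _ hx.2,
    ← Trivialization.continuousLinearMapAt_apply_of_mem (R := ℝ) _ hx.2, ← map_sub]
  rfl

theorem contMDiffOn_frameD (x₀ : M) :
    ContMDiffOn 𝓘(ℝ, EM) 𝓘(ℝ, NormalModel EG EM →L[ℝ] NormalModel EG EM) ∞ (L.frameD x₀)
      (L.ε ⁻¹' (L.triv x₀).baseSet) := by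
  have h := L.contMDiffOn_projCoord x₀ x₀
  rw [inter_self] at h
  exact contMDiffOn_const.clm_comp (h.clm_comp contMDiffOn_const)

theorem isOpen_normalBase (x₀ : M) : IsOpen (L.normalBase x₀) :=
  (L.contMDiffOn_frameD x₀).continuousOn.isOpen_inter_preimage
    ((L.triv x₀).open_baseSet.preimage L.contMDiff_ε.continuous) Units.isOpen

/-- The local trivialization of the normal bundle around `x₀`. -/
noncomputable def normalTriv (x₀ : M) :
    Pretrivialization (NormalModel EG EM) (π (NormalModel EG EM) L.Normal) where
  toFun p := (p.1, L.normalCoord x₀ p.1 p.2)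
  invFun q := ⟨q.1, L.normalCoordSymm x₀ q.1 q.2⟩
  source := π (NormalModel EG EM) L.Normal ⁻¹' L.normalBase x₀
  target := L.normalBase x₀ ×ˢ univ
  map_source' p hp := ⟨hp, mem_univ _⟩
  map_target' q hq := hq.1
  left_inv' := by
    rintro ⟨x, a⟩ hp
    exact congrArg (TotalSpace.mk x) (L.normalCoordSymm_normalCoord x₀ x hp a)
  right_inv' := by
    rintro ⟨x, w⟩ hq
    exact Prod.ext rfl (L.normalCoord_normalCoordSymm x₀ x hq.1 w)
  open_target := (L.isOpen_normalBase x₀).prod isOpen_univ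
  baseSet := L.normalBase x₀
  open_baseSet := L.isOpen_normalBase x₀
  source_eq := rfl
  target_eq := rfl
  proj_toFun p hp := rfl

instance (x₀ : M) : (L.normalTriv x₀).IsLinear ℝ where
  linear x _ := (L.normalCoord x₀ x).isLinear

/-- The change of coordinates between two local trivializations of the normal bundle. -/
noncomputable def normalChange (x₀ x₁ x : M) : NormalModel EG EM →L[ℝ] NormalModel EG EM :=
  (L.frameC x₁).comp ((L.projCoord x₀ x₁ x).comp
    ((L.frameS x₀).comp (Ring.inverse (L.frameD x₀ x))))

theorem contMDiffOn_normalChange (x₀ x₁ : M) :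
    ContMDiffOn 𝓘(ℝ, EM) 𝓘(ℝ, NormalModel EG EM →L[ℝ] NormalModel EG EM) ∞
      (L.normalChange x₀ x₁) (L.normalBase x₀ ∩ L.normalBase x₁) := by
  have hinv : ContMDiffOn 𝓘(ℝ, EM) 𝓘(ℝ, NormalModel EG EM →L[ℝ] NormalModel EG EM) ∞
      (fun x => Ring.inverse (L.frameD x₀ x)) (L.normalBase x₀ ∩ L.normalBase x₁) := by
    intro x hx
    obtain ⟨u, hu⟩ := hx.1.2
    have h1 := contDiffAt_ringInverse ℝ (n := ∞) u
    rw [hu] at h1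
    exact h1.contMDiffAt.comp_contMDiffWithinAt x
      ((L.contMDiffOn_frameD x₀ x hx.1.1).mono fun y hy => hy.1.1)
  have hp := (L.contMDiffOn_projCoord x₀ x₁).mono
    (show L.normalBase x₀ ∩ L.normalBase x₁ ⊆ _ from fun y hy => ⟨hy.1.1, hy.2.1⟩)
  exact contMDiffOn_const.clm_comp (hp.clm_comp (contMDiffOn_const.clm_comp hinv))

theorem normalChange_apply (x₀ x₁ x : M) (h : x ∈ L.normalBase x₀) (w : NormalModel EG EM) :
    L.normalChange x₀ x₁ x w =
      (L.normalTriv x₁ ⟨x, (L.normalTriv x₀).symm x w⟩).2 := by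
  have : (L.normalTriv x₀).symm x w = L.normalCoordSymm x₀ x w := by
    rw [Pretrivialization.symm_apply _ h]
    rfl
  rw [this]
  rfl

/-- The vector bundle structure of the normal bundle `AG`. -/
noncomputable def normalPrebundle : VectorPrebundle ℝ (NormalModel EG EM) L.Normal where
  pretrivializationAtlas := range L.normalTriv
  pretrivialization_linear' := by
    rintro _ ⟨x₀, rfl⟩
    infer_instance
  pretrivializationAt := L.normalTriv
  mem_base_pretrivializationAt := L.mem_normalBase
  pretrivialization_mem_atlas x := ⟨x, rfl⟩
  exists_coordChange := by
    rintro _ ⟨x₀, rfl⟩ _ ⟨x₁, rfl⟩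
    exact ⟨L.normalChange x₀ x₁, (L.contMDiffOn_normalChange x₀ x₁).continuousOn,
      fun x hx w => L.normalChange_apply x₀ x₁ x hx.1 w⟩
  totalSpaceMk_isInducing := by
    intro x
    change Topology.IsInducing (fun a : L.Normal x => (x, L.normalCoord x x a))
    rw [Topology.isInducing_const_prod]
    let e := LinearEquiv.ofBijective (L.normalCoord x x)
      (L.bijective_normalCoord x x (L.mem_normalBase x))
    exact e.toContinuousLinearEquiv.toHomeomorph.isInducing

instance : L.normalPrebundle.IsContMDiff 𝓘(ℝ, EM) ∞ where
  exists_contMDiffCoordChange := by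
    rintro _ ⟨x₀, rfl⟩ _ ⟨x₁, rfl⟩
    exact ⟨L.normalChange x₀ x₁, L.contMDiffOn_normalChange x₀ x₁,
      fun x hx w => L.normalChange_apply x₀ x₁ x hx.1 w⟩

noncomputable instance : TopologicalSpace (TotalSpace (NormalModel EG EM) L.Normal) :=
  L.normalPrebundle.totalSpaceTopology
noncomputable instance : FiberBundle (NormalModel EG EM) L.Normal :=
  L.normalPrebundle.toFiberBundle
instance : VectorBundle ℝ (NormalModel EG EM) L.Normal :=
  L.normalPrebundle.toVectorBundle
instance : ContMDiffVectorBundle ∞ (NormalModel EG EM) L.Normal 𝓘(ℝ, EM) :=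
  L.normalPrebundle.contMDiffVectorBundle 𝓘(ℝ, EM)

end Smooth
end FiniteDim
end SmoothQuasiloopoid

section Algebroid

variable {EM M : Type*} [NormedAddCommGroup EM] [NormedSpace ℝ EM]
  [TopologicalSpace M] [ChartedSpace EM M]

/-- `X` is a smooth section of the vector bundle `A → M` with model fibre `F`, where `M` is
modelled on `EM`. -/
def IsSmoothSection (EM F : Type*) {M : Type*} [NormedAddCommGroup EM] [NormedSpace ℝ EM]
    [TopologicalSpace M] [ChartedSpace EM M] [NormedAddCommGroup F] [NormedSpace ℝ F]
    {A : M → Type*} [∀ x, TopologicalSpace (A x)] [TopologicalSpace (TotalSpace F A)]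
    [FiberBundle F A] (X : ∀ x, A x) : Prop :=
  ContMDiff 𝓘(ℝ, EM) (𝓘(ℝ, EM).prod 𝓘(ℝ, F)) ∞ (fun x => TotalSpace.mk' F x (X x))

variable [IsManifold 𝓘(ℝ, EM) ∞ M]

/-- A skew algebroid structure on the vector bundle `A → M` with model fibre `F`: a skew-symmetric
`ℝ`-bilinear bracket `br` on the smooth sections and a vector bundle morphism `ρ : A → TM` over
the identity of `M`, related by the Leibniz rule `[X, f Y] = f [X, Y] + ρ(X)(f) Y`.
The values of `br` at non-smooth sections play no role. -/
structure IsSkewAlgebroid (F : Type*) [NormedAddCommGroup F] [NormedSpace ℝ F]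
    {A : M → Type*} [∀ x, AddCommGroup (A x)] [∀ x, Module ℝ (A x)]
    [∀ x, TopologicalSpace (A x)] [TopologicalSpace (TotalSpace F A)] [FiberBundle F A]
    [VectorBundle ℝ F A] [ContMDiffVectorBundle ∞ F A 𝓘(ℝ, EM)]
    (br : (∀ x, A x) → (∀ x, A x) → ∀ x, A x)
    (ρ : ∀ x, A x →ₗ[ℝ] TangentSpace 𝓘(ℝ, EM) x) : Prop where
  smooth_bracket : ∀ X Y : ∀ x, A x, IsSmoothSection EM F X → IsSmoothSection EM F Y →
    IsSmoothSection EM F (br X Y)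
  skew : ∀ X Y : ∀ x, A x, IsSmoothSection EM F X → IsSmoothSection EM F Y → br X Y = -br Y X
  add_left : ∀ X X' Y : ∀ x, A x, IsSmoothSection EM F X → IsSmoothSection EM F X' →
    IsSmoothSection EM F Y → br (X + X') Y = br X Y + br X' Y
  smul_left : ∀ (c : ℝ) (X Y : ∀ x, A x), IsSmoothSection EM F X → IsSmoothSection EM F Y →
    br (c • X) Y = c • br X Y
  smooth_anchor : ContMDiff (𝓘(ℝ, EM).prod 𝓘(ℝ, F)) 𝓘(ℝ, EM).tangent ∞
    (fun p : TotalSpace F A => (⟨p.1, ρ p.1 p.2⟩ : TangentBundle 𝓘(ℝ, EM) M))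
  leibniz : ∀ (f : M → ℝ) (X Y : ∀ x, A x), ContMDiff 𝓘(ℝ, EM) 𝓘(ℝ, ℝ) ∞ f →
    IsSmoothSection EM F X → IsSmoothSection EM F Y → ∀ x,
    br X (fun y => f y • Y y) x =
      f x • br X Y x + NormedSpace.fromTangentSpace (𝕜 := ℝ) (f x)
        (mfderiv 𝓘(ℝ, EM) 𝓘(ℝ, ℝ) f x (ρ x (X x))) • Y x

/-- An almost Lie algebroid: a skew algebroid whose anchor is a homomorphism from the bracket of
sections to the Lie bracket of vector fields. -/
structure IsAlmostLieAlgebroid (F : Type*) [NormedAddCommGroup F] [NormedSpace ℝ F]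
    {A : M → Type*} [∀ x, AddCommGroup (A x)] [∀ x, Module ℝ (A x)]
    [∀ x, TopologicalSpace (A x)] [TopologicalSpace (TotalSpace F A)] [FiberBundle F A]
    [VectorBundle ℝ F A] [ContMDiffVectorBundle ∞ F A 𝓘(ℝ, EM)]
    (br : (∀ x, A x) → (∀ x, A x) → ∀ x, A x)
    (ρ : ∀ x, A x →ₗ[ℝ] TangentSpace 𝓘(ℝ, EM) x) : Prop extends IsSkewAlgebroid F br ρ where
  anchor_bracket : ∀ X Y : ∀ x, A x, IsSmoothSection EM F X → IsSmoothSection EM F Y → ∀ x,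
    ρ x (br X Y x) = mlieBracket 𝓘(ℝ, EM) (fun y => ρ y (X y)) (fun y => ρ y (Y y)) x

end Algebroid

namespace SmoothQuasiloopoid

variable {EG EM G M : Type*}
  [NormedAddCommGroup EG] [NormedSpace ℝ EG] [NormedAddCommGroup EM] [NormedSpace ℝ EM]
  [TopologicalSpace G] [ChartedSpace EG G] [TopologicalSpace M] [ChartedSpace EM M]
  (L : SmoothQuasiloopoid EG EM G M)

/-- The left prolongation `g ↦ T l_g (X̄^α (β g))` of a section `X` of `AG`; this is a vector at
`mul g (ε (β g)) = g`. -/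
noncomputable def leftProlongation (X : ∀ x, L.Normal x) (g : G) : TangentSpace 𝓘(ℝ, EG) g :=
  mfderivWithin 𝓘(ℝ, EG) 𝓘(ℝ, EG) (fun h => L.mul g h) {h | L.α h = L.β g}
    (L.ε (L.β g)) (L.repα (L.β g) (X (L.β g)))

/-- The right prolongation `g ↦ T r_g (X̄^β (α g))` of a section `X` of `AG`; this is a vector at
`mul (ε (α g)) g = g`. -/
noncomputable def rightProlongation (X : ∀ x, L.Normal x) (g : G) : TangentSpace 𝓘(ℝ, EG) g :=
  mfderivWithin 𝓘(ℝ, EG) 𝓘(ℝ, EG) (fun h => L.mul h g) {h | L.β h = L.α g}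
    (L.ε (L.α g)) (L.repβ (L.α g) (X (L.α g)))

/-- The left bracket of sections of `AG`: the normal part along `M` of the Lie bracket of the left
prolongations. -/
noncomputable def leftBracket (X Y : ∀ x, L.Normal x) (x : M) : L.Normal x :=
  L.normalMk x (mlieBracket 𝓘(ℝ, EG) (L.leftProlongation X) (L.leftProlongation Y) (L.ε x))

/-- The right bracket of sections of `AG`: the normal part along `M` of the Lie bracket of the
right prolongations. -/
noncomputable def rightBracket (X Y : ∀ x, L.Normal x) (x : M) : L.Normal x :=
  L.normalMk x (mlieBracket 𝓘(ℝ, EG) (L.rightProlongation X) (L.rightProlongation Y) (L.ε x))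

/-- The left anchor `X ↦ Tβ (X̄^α)`. -/
noncomputable def leftAnchor (x : M) : L.Normal x →ₗ[ℝ] TangentSpace 𝓘(ℝ, EM) x :=
  (L.Tβ x).toLinearMap ∘ₗ L.repα x

/-- The right anchor `X ↦ Tα (X̄^β)`. -/
noncomputable def rightAnchor (x : M) : L.Normal x →ₗ[ℝ] TangentSpace 𝓘(ℝ, EM) x :=
  (L.Tα x).toLinearMap ∘ₗ L.repβ x

end SmoothQuasiloopoid

/-! Translations map fibres to fibres, so `α (g h) = α g` and `β (g h) = β h`. Differentiating along
`l_g`, the left prolongation of `X` is `α`-related to `0` and `β`-related to `ρ_l(X)`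
(`mfderiv_α_leftProlongation`, `mfderiv_β_leftProlongation`). Brackets of related fields are related
(`mfderiv_mlieBracket_of_related`). So at a unit the bracket of two left prolongations is tangent to
the `α`-fibre: it is the `α`-representative of its own normal class, and `Tβ` sends it to `[ρ_l X,
ρ_l Y]`. The Leibniz rule holds because `f X` prolongs to `(f ∘ β)` times the prolongation of `X`,
which equals `X̄^α` on the units. The bracket of prolongations need not itself be a prolongation;
only its class along the units is kept.

The analytic difficulty is smoothness: `T l_g` is a derivative along a fibre that moves with `g`. A
smooth family of local retractions onto the fibres (`exists_retraction`) extends `l_g` to an open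
set, jointly smoothly in `g`, and shows that derivatives within a fibre are determined on tangent
vectors.

The right-hand statements are the left-hand ones for the opposite quasiloopoid, once its normal
bundle is seen to carry the same smooth structure (`contMDiff_toOp`). On the class of `v` the
anchors are `±(Tα v - Tβ v)`. -/

/-! ### Local retractions onto the fibres of a submersion. -/

section Submersion

variable {E E' M N : Type*} [NormedAddCommGroup E] [NormedSpace ℝ E]
  [NormedAddCommGroup E'] [NormedSpace ℝ E'] [TopologicalSpace M] [ChartedSpace E M]
  [TopologicalSpace N] [ChartedSpace E' N] {f : M → N}

/-- Near the graph of a submersion there is a smooth family of local retractions onto the fibres. -/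
theorem Manifold.IsSubmersion.exists_retraction [IsManifold 𝓘(ℝ, E) ∞ M] [IsManifold 𝓘(ℝ, E') ∞ N]
    (hf : IsSubmersion 𝓘(ℝ, E) 𝓘(ℝ, E') ∞ f) (x : M) :
    ∃ (U : Set (N × M)) (Q : N × M → M), IsOpen U ∧ (f x, x) ∈ U ∧
      ContMDiffOn (𝓘(ℝ, E').prod 𝓘(ℝ, E)) 𝓘(ℝ, E) ∞ Q U ∧
      (∀ p ∈ U, f (Q p) = p.1) ∧ ∀ y, (f y, y) ∈ U → Q (f y, y) = y := by
  obtain ⟨F, _, _, φ, ψ, hx, hfx, hφ, hψ, hsub, e, he⟩ := hf.isSubmersionAt x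
  have he' : ∀ y ∈ φ.target, ψ (f (φ.symm y)) = (e y).1 := fun y hy => he (by simpa using hy)
  have hemb : ∀ y ∈ φ.source, ψ (f y) = (e (φ y)).1 := fun y hy => by
    simpa [φ.left_inv hy] using he' (φ y) (φ.map_source hy)
  -- In these charts `f` is the first projection, so replacing the first component by `ψ p.1` moves
  -- the point into the fibre over `p.1` and changes nothing on the graph of `f`.
  let c : N × M → E := fun p => e.symm (ψ p.1, (e (φ p.2)).2)
  have hc : ContMDiffOn (𝓘(ℝ, E').prod 𝓘(ℝ, E)) 𝓘(ℝ, E) ∞ c (ψ.source ×ˢ φ.source) := by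
    have h1 : ContMDiffOn (𝓘(ℝ, E').prod 𝓘(ℝ, E)) 𝓘(ℝ, E') ∞ (fun p : N × M => ψ p.1)
        (ψ.source ×ˢ φ.source) :=
      (contMDiffOn_of_mem_maximalAtlas hψ).comp contMDiffOn_fst fun p hp => hp.1
    have h2 : ContMDiffOn (𝓘(ℝ, E').prod 𝓘(ℝ, E)) 𝓘(ℝ, E) ∞ (fun p : N × M => φ p.2)
        (ψ.source ×ˢ φ.source) :=
      (contMDiffOn_of_mem_maximalAtlas hφ).comp contMDiffOn_snd fun p hp => hp.2
    have h3 : ContMDiffOn (𝓘(ℝ, E').prod 𝓘(ℝ, E)) 𝓘(ℝ, F) ∞ (fun p : N × M => (e (φ p.2)).2)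
        (ψ.source ×ˢ φ.source) :=
      (contDiff_snd.comp e.contDiff).contMDiff.comp_contMDiffOn h2
    exact e.symm.contDiff.contMDiff.comp_contMDiffOn (h1.prodMk_space h3)
  have hcg : ∀ y ∈ φ.source, c (f y, y) = φ y := fun y hy => by
    simp only [c, hemb y hy, Prod.mk.eta, e.symm_apply_apply]
  refine ⟨(ψ.source ×ˢ φ.source) ∩ c ⁻¹' φ.target, fun p => φ.symm (c p),
    hc.continuousOn.isOpen_inter_preimage (ψ.open_source.prod φ.open_source) φ.open_target,
    ⟨⟨hfx, hx⟩, ?_⟩, ?_, ?_, ?_⟩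
  · change c (f x, x) ∈ φ.target
    rw [hcg x hx]
    exact φ.map_source hx
  · exact (contMDiffOn_symm_of_mem_maximalAtlas hφ).comp (hc.mono inter_subset_left)
      fun p hp => hp.2
  · rintro p ⟨⟨h1, h2⟩, h3⟩
    refine ψ.injOn (hsub (φ.map_target h3)) h1 ?_
    rw [he' _ h3]
    simp [c]
  · rintro y ⟨⟨-, hy⟩, -⟩
    change φ.symm (c (f y, y)) = y
    rw [hcg y hy, φ.left_inv hy]

/-- A local retraction onto a fibre does not move the vectors tangent to this fibre. -/
theorem mfderiv_retraction_apply {U : Set (N × M)} {Q : N × M → M} {y : M}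
    (hU : IsOpen U) (hyU : (f y, y) ∈ U)
    (hQ : ContMDiffOn (𝓘(ℝ, E').prod 𝓘(ℝ, E)) 𝓘(ℝ, E) ∞ Q U)
    (hQf : ∀ y, (f y, y) ∈ U → Q (f y, y) = y)
    (hf : ContMDiff 𝓘(ℝ, E) 𝓘(ℝ, E') ∞ f) (v : TangentSpace 𝓘(ℝ, E) y)
    (hv : mfderiv 𝓘(ℝ, E) 𝓘(ℝ, E') f y v = 0) :
    mfderiv 𝓘(ℝ, E) 𝓘(ℝ, E) (fun z => Q (f y, z)) y v = v := by
  have hQ' : MDifferentiableAt (𝓘(ℝ, E').prod 𝓘(ℝ, E)) 𝓘(ℝ, E) Q (f y, y) :=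
    (hQ.contMDiffAt (hU.mem_nhds hyU)).mdifferentiableAt (by simp)
  have hfd := hf.mdifferentiable (by simp) y
  have hev : (fun z => Q (f z, z)) =ᶠ[𝓝 y] id := by
    have : ContinuousAt (fun z => (f z, z)) y := hf.continuous.continuousAt.prodMk continuousAt_id
    filter_upwards [this (hU.mem_nhds hyU)] with z hz using hQf z hz
  let D : E' × E →L[ℝ] E := mfderiv (𝓘(ℝ, E').prod 𝓘(ℝ, E)) 𝓘(ℝ, E) Q (f y, y)
  let T : E →L[ℝ] E' := mfderiv 𝓘(ℝ, E) 𝓘(ℝ, E') f y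
  have hD : HasMFDerivAt (𝓘(ℝ, E').prod 𝓘(ℝ, E)) 𝓘(ℝ, E) Q (f y, y) D := hQ'.hasMFDerivAt
  have h1 : HasMFDerivAt 𝓘(ℝ, E) 𝓘(ℝ, E) (fun z => Q (f z, z)) y
      (D.comp (T.prod (ContinuousLinearMap.id ℝ E))) :=
    HasMFDerivAt.comp y hD (hfd.hasMFDerivAt.prodMk (hasMFDerivAt_id y))
  have h2 : HasMFDerivAt 𝓘(ℝ, E) 𝓘(ℝ, E) (fun z => Q (f y, z)) y
      (D.comp ((0 : E →L[ℝ] E').prod (ContinuousLinearMap.id ℝ E))) :=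
    HasMFDerivAt.comp (f := fun z => (f y, z)) y hD
      ((hasMFDerivAt_const (f y) y).prodMk (hasMFDerivAt_id y))
  -- This differentiates `Q (f z, z) = z`. Since `T v = 0`, only the partial derivative in the
  -- second variable acts on `v`.
  have h3 : D.comp (T.prod (ContinuousLinearMap.id ℝ E)) = ContinuousLinearMap.id ℝ E :=
    hasMFDerivAt_unique h1 ((hasMFDerivAt_id y).congr_of_eventuallyEq hev)
  have h4 : D (T v, v) = v := DFunLike.congr_fun h3 v
  rw [h2.mfderiv]
  change D (0, v) = v
  rwa [show T v = 0 from hv] at h4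

end Submersion

/-! ### Lie brackets of related vector fields. -/

section Related

theorem two_le_infty : (2 : WithTop ℕ∞) ≤ ∞ :=
  WithTop.coe_le_coe.2 (le_top (a := (2 : ℕ∞)))

/-- The Lie bracket of related vector fields, in normed spaces. -/
theorem VectorField.fderiv_lieBracket_of_related {E E' : Type*} [NormedAddCommGroup E]
    [NormedSpace ℝ E] [NormedAddCommGroup E'] [NormedSpace ℝ E'] {F : E → E'} {u : E}
    {V₁ V₂ : E → E} {W₁ W₂ : E' → E'} (hF : ContDiffAt ℝ 2 F u)
    (hV₁ : DifferentiableAt ℝ V₁ u) (hV₂ : DifferentiableAt ℝ V₂ u)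
    (hW₁ : DifferentiableAt ℝ W₁ (F u)) (hW₂ : DifferentiableAt ℝ W₂ (F u))
    (h₁ : ∀ᶠ y in 𝓝 u, fderiv ℝ F y (V₁ y) = W₁ (F y))
    (h₂ : ∀ᶠ y in 𝓝 u, fderiv ℝ F y (V₂ y) = W₂ (F y)) :
    fderiv ℝ F u (lieBracket ℝ V₁ V₂ u) = lieBracket ℝ W₁ W₂ (F u) := by
  have hF1 : DifferentiableAt ℝ F u := hF.differentiableAt (by simp)
  have hF2 : DifferentiableAt ℝ (fderiv ℝ F) u :=
    (hF.fderiv_right (m := 1) (by norm_num)).differentiableAt (by simp)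
  -- The derivative of the relation `DF(V) = W ∘ F` in the direction `v`. In the difference of the
  -- two instances below, the second derivatives of `F` cancel by symmetry.
  have key : ∀ {V : E → E} {W : E' → E'}, DifferentiableAt ℝ V u → DifferentiableAt ℝ W (F u) →
      (∀ᶠ y in 𝓝 u, fderiv ℝ F y (V y) = W (F y)) → ∀ v,
      fderiv ℝ F u (fderiv ℝ V u v) + fderiv ℝ (fderiv ℝ F) u v (V u) =
        fderiv ℝ W (F u) (fderiv ℝ F u v) := by
    intro V W hV hW h v
    have e1 := hF2.hasFDerivAt.clm_apply hV.hasFDerivAt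
    have e2 : HasFDerivAt (fun y => W (F y)) _ u := hW.hasFDerivAt.comp u hF1.hasFDerivAt
    have e3 := e1.unique (e2.congr_of_eventuallyEq h)
    simpa using DFunLike.congr_fun e3 v
  have k1 := key hV₂ hW₂ h₂ (V₁ u)
  have k2 := key hV₁ hW₁ h₁ (V₂ u)
  have hs : fderiv ℝ (fderiv ℝ F) u (V₁ u) (V₂ u) = fderiv ℝ (fderiv ℝ F) u (V₂ u) (V₁ u) :=
    (hF.isSymmSndFDerivAt (by simp)) _ _
  rw [h₁.self_of_nhds] at k1
  rw [h₂.self_of_nhds] at k2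
  rw [lieBracket, lieBracket, map_sub, ← k1, ← k2, hs]
  abel

section Coordinates

variable {E M : Type*} [NormedAddCommGroup E] [NormedSpace ℝ E]
  [TopologicalSpace M] [ChartedSpace E M]

/-- A vector field in the coordinates of the preferred chart at `x`. -/
theorem mpullbackWithin_extChartAt_symm_apply [IsManifold 𝓘(ℝ, E) 1 M] (x : M)
    (V : ∀ y : M, TangentSpace 𝓘(ℝ, E) y) {y : M} (hy : y ∈ (extChartAt 𝓘(ℝ, E) x).source) :
    mpullbackWithin 𝓘(ℝ, E) 𝓘(ℝ, E) (extChartAt 𝓘(ℝ, E) x).symm V (range 𝓘(ℝ, E))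
      (extChartAt 𝓘(ℝ, E) x y) = mfderiv 𝓘(ℝ, E) 𝓘(ℝ, E) (extChartAt 𝓘(ℝ, E) x) y (V y) := by
  have h1 := mfderivWithin_extChartAt_symm_comp_mfderiv_extChartAt' (I := 𝓘(ℝ, E)) hy
  have h2 := isInvertible_mfderivWithin_extChartAt_symm (I := 𝓘(ℝ, E))
    ((extChartAt 𝓘(ℝ, E) x).map_source hy)
  have h3 := (extChartAt 𝓘(ℝ, E) x).left_inv hy
  obtain ⟨A, hA⟩ := h2
  rw [mpullbackWithin_apply, ← hA]
  rw [← hA] at h1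
  -- The values of `V` at equal points have different types; as a map into `E` it can be rewritten
  -- along `h3`.
  let V' : M → E := V
  have h4 : V' ((extChartAt 𝓘(ℝ, E) x).symm (extChartAt 𝓘(ℝ, E) x y)) = V' y := by rw [h3]
  rw [ContinuousLinearMap.inverse_equiv]
  have h5 := DFunLike.congr_fun h1 (V y)
  have h6 : A (mfderiv 𝓘(ℝ, E) 𝓘(ℝ, E) (extChartAt 𝓘(ℝ, E) x) y (V y)) =
    V' ((extChartAt 𝓘(ℝ, E) x).symm (extChartAt 𝓘(ℝ, E) x y)) := h5.trans h4.symm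
  exact A.symm_apply_eq.2 h6.symm

/-- The bracket on a manifold is the bracket in the chart, carried back by the inverse of the
derivative of the chart; at its own base point the preferred chart has derivative the identity. -/
theorem mlieBracket_eq_lieBracket_extChartAt [IsManifold 𝓘(ℝ, E) 1 M]
    (V W : ∀ y : M, TangentSpace 𝓘(ℝ, E) y) (x : M) :
    mlieBracket 𝓘(ℝ, E) V W x = lieBracket ℝ
      (mpullbackWithin 𝓘(ℝ, E) 𝓘(ℝ, E) (extChartAt 𝓘(ℝ, E) x).symm V (range 𝓘(ℝ, E)))
      (mpullbackWithin 𝓘(ℝ, E) 𝓘(ℝ, E) (extChartAt 𝓘(ℝ, E) x).symm W (range 𝓘(ℝ, E)))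
      (extChartAt 𝓘(ℝ, E) x x) := by
  have h : ∀ v : E, (mfderiv 𝓘(ℝ, E) 𝓘(ℝ, E) (extChartAt 𝓘(ℝ, E) x) x).inverse v = v := by
    intro v
    rw [mfderiv_extChartAt_self]
    exact DFunLike.congr_fun (ContinuousLinearMap.inverse_id (R := ℝ) (M := E)) v
  rw [← mlieBracketWithin_univ, mlieBracketWithin_apply]
  refine (h _).trans ?_
  have hs : (extChartAt 𝓘(ℝ, E) x).symm ⁻¹' univ ∩ range 𝓘(ℝ, E) = univ := by simp
  refine (congrArg (fun s => lieBracketWithin ℝ _ _ s _) hs).trans ?_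
  exact congrFun (lieBracketWithin_univ (E := E)) _

end Coordinates

variable {E E' M N : Type*} [NormedAddCommGroup E] [NormedSpace ℝ E] [CompleteSpace E]
  [NormedAddCommGroup E'] [NormedSpace ℝ E'] [CompleteSpace E']
  [TopologicalSpace M] [ChartedSpace E M] [IsManifold 𝓘(ℝ, E) ∞ M]
  [TopologicalSpace N] [ChartedSpace E' N] [IsManifold 𝓘(ℝ, E') ∞ N] {f : M → N}

/-- If `V₁, V₂` are `f`-related to `W₁, W₂`, then `[V₁, V₂]` is `f`-related to `[W₁, W₂]`. -/
theorem VectorField.mfderiv_mlieBracket_of_related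
    (hf : ContMDiff 𝓘(ℝ, E) 𝓘(ℝ, E') ∞ f)
    {V₁ V₂ : ∀ x : M, TangentSpace 𝓘(ℝ, E) x} {W₁ W₂ : ∀ x : N, TangentSpace 𝓘(ℝ, E') x} {x : M}
    (hV₁ : MDifferentiableAt 𝓘(ℝ, E) 𝓘(ℝ, E).tangent
      (fun y => (⟨y, V₁ y⟩ : TangentBundle 𝓘(ℝ, E) M)) x)
    (hV₂ : MDifferentiableAt 𝓘(ℝ, E) 𝓘(ℝ, E).tangent
      (fun y => (⟨y, V₂ y⟩ : TangentBundle 𝓘(ℝ, E) M)) x)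
    (hW₁ : MDifferentiableAt 𝓘(ℝ, E') 𝓘(ℝ, E').tangent
      (fun y => (⟨y, W₁ y⟩ : TangentBundle 𝓘(ℝ, E') N)) (f x))
    (hW₂ : MDifferentiableAt 𝓘(ℝ, E') 𝓘(ℝ, E').tangent
      (fun y => (⟨y, W₂ y⟩ : TangentBundle 𝓘(ℝ, E') N)) (f x))
    (h₁ : ∀ y, mfderiv 𝓘(ℝ, E) 𝓘(ℝ, E') f y (V₁ y) = W₁ (f y))
    (h₂ : ∀ y, mfderiv 𝓘(ℝ, E) 𝓘(ℝ, E') f y (V₂ y) = W₂ (f y)) :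
    mfderiv 𝓘(ℝ, E) 𝓘(ℝ, E') f x (mlieBracket 𝓘(ℝ, E) V₁ V₂ x) =
      mlieBracket 𝓘(ℝ, E') W₁ W₂ (f x) := by
  have : IsManifold 𝓘(ℝ, E) 1 M := IsManifold.of_le (n := ∞) (by simp)
  have : IsManifold 𝓘(ℝ, E') 1 N := IsManifold.of_le (n := ∞) (by simp)
  have : IsManifold 𝓘(ℝ, E) 2 M := IsManifold.of_le (n := ∞) two_le_infty
  have : IsManifold 𝓘(ℝ, E') 2 N := IsManifold.of_le (n := ∞) two_le_infty
  set φ := extChartAt 𝓘(ℝ, E) x with hφ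
  set ψ := extChartAt 𝓘(ℝ, E') (f x) with hψ
  let F : E → E' := ψ ∘ f ∘ φ.symm
  have hF : ContDiffAt ℝ 2 F (φ x) := by
    have := (contMDiffAt_iff.1 (hf x)).2
    simp only [modelWithCornersSelf_coe, range_id, contDiffWithinAt_univ] at this
    exact this.of_le two_le_infty
  have hxs : φ.symm (φ x) = x := extChartAt_to_inv x
  have hFx : F (φ x) = ψ (f x) := by simp only [F, Function.comp_apply, hxs]
  have hdiff : ∀ {V : ∀ x : M, TangentSpace 𝓘(ℝ, E) x}, MDifferentiableAt 𝓘(ℝ, E) 𝓘(ℝ, E).tangent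
      (fun y => (⟨y, V y⟩ : TangentBundle 𝓘(ℝ, E) M)) x → DifferentiableAt ℝ
      (mpullbackWithin 𝓘(ℝ, E) 𝓘(ℝ, E) φ.symm V (range 𝓘(ℝ, E))) (φ x) := by
    intro V hV
    exact (hV.mdifferentiableWithinAt (s := univ)
      |>.differentiableWithinAt_mpullbackWithin_vectorField).differentiableAt (by simp)
  have hdiff' : ∀ {V : ∀ x : N, TangentSpace 𝓘(ℝ, E') x},
      MDifferentiableAt 𝓘(ℝ, E') 𝓘(ℝ, E').tangent
      (fun y => (⟨y, V y⟩ : TangentBundle 𝓘(ℝ, E') N)) (f x) → DifferentiableAt ℝ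
      (mpullbackWithin 𝓘(ℝ, E') 𝓘(ℝ, E') ψ.symm V (range 𝓘(ℝ, E'))) (F (φ x)) := by
    intro V hV
    rw [hFx]
    exact (hV.mdifferentiableWithinAt (s := univ)
      |>.differentiableWithinAt_mpullbackWithin_vectorField).differentiableAt (by simp)
  have hderiv : ∀ {y : M}, y ∈ φ.source → f y ∈ ψ.source → ∀ v : TangentSpace 𝓘(ℝ, E) y,
      fderiv ℝ F (φ y) (mfderiv 𝓘(ℝ, E) 𝓘(ℝ, E) φ y v) =
        mfderiv 𝓘(ℝ, E') 𝓘(ℝ, E') ψ (f y) (mfderiv 𝓘(ℝ, E) 𝓘(ℝ, E') f y v) := by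
    intro y hy hfy v
    have hsy := φ.left_inv hy
    have d1 : MDifferentiableAt 𝓘(ℝ, E) 𝓘(ℝ, E) φ y :=
      mdifferentiableAt_extChartAt (by rwa [hφ, extChartAt_source] at hy)
    have d2 : MDifferentiableAt 𝓘(ℝ, E') 𝓘(ℝ, E') ψ (f y) :=
      mdifferentiableAt_extChartAt (by rwa [hψ, extChartAt_source] at hfy)
    have d3 : MDifferentiableAt 𝓘(ℝ, E) 𝓘(ℝ, E) φ.symm (φ y) := by
      have := mdifferentiableWithinAt_extChartAt_symm (I := 𝓘(ℝ, E)) (φ.map_source hy)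
      rwa [modelWithCornersSelf_coe, range_id, mdifferentiableWithinAt_univ] at this
    have d4 : MDifferentiable 𝓘(ℝ, E) 𝓘(ℝ, E') f := hf.mdifferentiable (by simp)
    have d5 : MDifferentiableAt 𝓘(ℝ, E) 𝓘(ℝ, E') F (φ y) :=
      MDifferentiableAt.comp_of_eq (g := ψ ∘ f) (f := φ.symm) (φ y)
        (d2.comp y (d4 y)) d3 hsy
    have e : F ∘ φ =ᶠ[𝓝 y] ψ ∘ f := by
      filter_upwards [(isOpen_extChartAt_source (I := 𝓘(ℝ, E)) x).mem_nhds hy] with z hz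
      simp only [F, Function.comp_apply, φ.left_inv hz]
    have e1 := mfderiv_comp y d5 d1
    rw [e.mfderiv_eq, mfderiv_comp y d2 (d4 y), mfderiv_eq_fderiv] at e1
    exact (DFunLike.congr_fun e1 v).symm
  -- The bracket differentiates the fields, so relatedness must be transferred to the charts on a
  -- whole neighbourhood.
  have hrel : ∀ {V : ∀ x : M, TangentSpace 𝓘(ℝ, E) x} {W : ∀ x : N, TangentSpace 𝓘(ℝ, E') x},
      (∀ y, mfderiv 𝓘(ℝ, E) 𝓘(ℝ, E') f y (V y) = W (f y)) → ∀ᶠ u in 𝓝 (φ x),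
      fderiv ℝ F u (mpullbackWithin 𝓘(ℝ, E) 𝓘(ℝ, E) φ.symm V (range 𝓘(ℝ, E)) u) =
        mpullbackWithin 𝓘(ℝ, E') 𝓘(ℝ, E') ψ.symm W (range 𝓘(ℝ, E')) (F u) := by
    intro V W h
    have e1 : ∀ᶠ u in 𝓝 (φ x), u ∈ φ.target := extChartAt_target_mem_nhds x
    have e2 : ∀ᶠ u in 𝓝 (φ x), f (φ.symm u) ∈ ψ.source := by
      have : ContinuousAt (f ∘ φ.symm) (φ x) :=
        hf.continuous.continuousAt.comp (continuousAt_extChartAt_symm x)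
      refine this (extChartAt_source_mem_nhds' ?_)
      rw [Function.comp_apply, hxs]
      exact mem_extChartAt_source _
    filter_upwards [e1, e2] with u hu hfu
    obtain ⟨y, hy, rfl⟩ : ∃ y ∈ φ.source, φ y = u := ⟨φ.symm u, φ.map_target hu, φ.right_inv hu⟩
    rw [φ.left_inv hy] at hfu
    have e3 : F (φ y) = ψ (f y) := by simp only [F, Function.comp_apply, φ.left_inv hy]
    rw [mpullbackWithin_extChartAt_symm_apply x V hy, hderiv hy hfu, h, e3]
    exact (mpullbackWithin_extChartAt_symm_apply (f x) W hfu).symm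
  have main := fderiv_lieBracket_of_related hF (hdiff hV₁) (hdiff hV₂) (hdiff' hW₁) (hdiff' hW₂)
    (hrel h₁) (hrel h₂)
  rw [mlieBracket_eq_lieBracket_extChartAt, mlieBracket_eq_lieBracket_extChartAt, ← hφ, ← hψ, ← hFx,
    ← main]
  -- At `x` and `f x` the chart derivatives are identities, so the derivative of `F` is that of `f`.
  have := hderiv (mem_extChartAt_source x) (mem_extChartAt_source (f x))
  rw [mfderiv_extChartAt_self, mfderiv_extChartAt_self] at this
  exact (this _).symm

end Related

/-! ### Smoothness of representatives and of normal classes. -/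

namespace SmoothQuasiloopoid

section NormalBundle

variable {EG EM G M : Type*}
  [NormedAddCommGroup EG] [NormedSpace ℝ EG] [FiniteDimensional ℝ EG]
  [NormedAddCommGroup EM] [NormedSpace ℝ EM]
  [TopologicalSpace G] [ChartedSpace EG G] [IsManifold 𝓘(ℝ, EG) ∞ G]
  [TopologicalSpace M] [ChartedSpace EM M] [IsManifold 𝓘(ℝ, EM) ∞ M]
  (L : SmoothQuasiloopoid EG EM G M)

omit [FiniteDimensional ℝ EG] [IsManifold 𝓘(ℝ, EM) ∞ M] in
theorem projCoord_triv {x₀ x₁ x : M} (h : L.ε x ∈ (L.triv x₀).baseSet)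
    (v : TangentSpace 𝓘(ℝ, EG) (L.ε x)) :
    L.projCoord x₀ x₁ x ((L.triv x₀).continuousLinearMapAt ℝ (L.ε x) v) =
      (L.triv x₁).continuousLinearMapAt ℝ (L.ε x) (L.projα x v) := by
  change (L.triv x₁).continuousLinearMapAt ℝ (L.ε x) (L.projα x
    ((L.triv x₀).symmL ℝ (L.ε x) ((L.triv x₀).continuousLinearMapAt ℝ (L.ε x) v))) = _
  rw [Trivialization.symmL_continuousLinearMapAt _ h]

/-- The representative tangent to the `α`-fibre depends smoothly on the normal vector. -/
theorem contMDiff_repα : ContMDiff (𝓘(ℝ, EM).prod 𝓘(ℝ, NormalModel EG EM)) 𝓘(ℝ, EG).tangent ∞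
    (fun p : TotalSpace (NormalModel EG EM) L.Normal =>
      (⟨L.ε p.1, L.repα p.1 p.2⟩ : TangentBundle 𝓘(ℝ, EG) G)) := by
  intro p₀
  set x₀ := p₀.1 with hx₀
  -- Read in the local trivialization, smoothness of the identity says that the base point and the
  -- normal coordinates are smooth functions.
  have hid := contMDiffAt_totalSpace.1
    (contMDiffAt_id (x := p₀) (n := ∞) (I := 𝓘(ℝ, EM).prod 𝓘(ℝ, NormalModel EG EM)))
  have hproj : ContMDiffAt (𝓘(ℝ, EM).prod 𝓘(ℝ, NormalModel EG EM)) 𝓘(ℝ, EM) ∞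
    (fun p : TotalSpace (NormalModel EG EM) L.Normal => p.1) p₀ := hid.1
  have hw : ContMDiffAt (𝓘(ℝ, EM).prod 𝓘(ℝ, NormalModel EG EM)) 𝓘(ℝ, NormalModel EG EM) ∞
    (fun p : TotalSpace (NormalModel EG EM) L.Normal => L.normalCoord x₀ p.1 p.2) p₀ := hid.2
  have hmem := L.mem_normalBase x₀
  have hinv : ContMDiffAt 𝓘(ℝ, EM) 𝓘(ℝ, NormalModel EG EM →L[ℝ] NormalModel EG EM) ∞
      (fun x => Ring.inverse (L.frameD x₀ x)) x₀ := by
    obtain ⟨u, hu⟩ := hmem.2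
    have h1 := contDiffAt_ringInverse ℝ (n := ∞) u
    rw [hu] at h1
    refine h1.contMDiffAt.comp x₀ ((L.contMDiffOn_frameD x₀).contMDiffAt ?_)
    exact ((L.triv x₀).open_baseSet.preimage L.contMDiff_ε.continuous).mem_nhds hmem.1
  have hP : ContMDiffAt 𝓘(ℝ, EM) 𝓘(ℝ, EG →L[ℝ] EG) ∞ (L.projCoord x₀ x₀) x₀ := by
    refine (L.contMDiffOn_projCoord x₀ x₀).contMDiffAt ?_
    rw [inter_self]
    exact ((L.triv x₀).open_baseSet.preimage L.contMDiff_ε.continuous).mem_nhds hmem.1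
  rw [contMDiffAt_totalSpace]
  refine ⟨L.contMDiff_ε.contMDiffAt.comp p₀ hproj, ?_⟩
  -- A normal vector with coordinates `w` is the class of the vector with coordinates `frameS
  -- (frameD⁻¹ w)`; its `α`-representative is the projection of that vector.
  have hu : ContMDiffAt (𝓘(ℝ, EM).prod 𝓘(ℝ, NormalModel EG EM)) 𝓘(ℝ, EG) ∞
      (fun p : TotalSpace (NormalModel EG EM) L.Normal => L.projCoord x₀ x₀ p.1
        (L.frameS x₀ (Ring.inverse (L.frameD x₀ p.1) (L.normalCoord x₀ p.1 p.2)))) p₀ :=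
    (hP.comp p₀ hproj).clm_apply ((L.frameS x₀).contDiff.contMDiff.contMDiffAt.comp p₀
      ((hinv.comp p₀ hproj).clm_apply hw))
  refine hu.congr_of_eventuallyEq ?_
  filter_upwards [hproj.continuousAt ((L.isOpen_normalBase x₀).mem_nhds hmem)] with p hp
  have hp' : p.1 ∈ L.normalBase x₀ := hp
  have h1 := L.normalCoordSymm_normalCoord x₀ p.1 hp' p.2
  rw [← Trivialization.continuousLinearMapAt_apply_of_mem (R := ℝ) (L.triv x₀) hp'.1]
  conv_lhs => rw [← h1]
  rfl

/-- The normal class of a smooth vector field along the units is smooth. -/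
theorem contMDiff_normalMk {EN HN N : Type*} [NormedAddCommGroup EN] [NormedSpace ℝ EN]
    [TopologicalSpace HN] {IN : ModelWithCorners ℝ EN HN} [TopologicalSpace N] [ChartedSpace HN N]
    {b : N → M} (hb : ContMDiff IN 𝓘(ℝ, EM) ∞ b) {V : ∀ y, TangentSpace 𝓘(ℝ, EG) (L.ε (b y))}
    (hV : ContMDiff IN 𝓘(ℝ, EG).tangent ∞
      (fun y => (⟨L.ε (b y), V y⟩ : TangentBundle 𝓘(ℝ, EG) G))) :
    ContMDiff IN (𝓘(ℝ, EM).prod 𝓘(ℝ, NormalModel EG EM)) ∞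
      (fun y => TotalSpace.mk' (NormalModel EG EM) (b y) (L.normalMk (b y) (V y))) := by
  intro y₀
  set x₀ := b y₀ with hx₀
  have hmem : L.ε x₀ ∈ (L.triv x₀).baseSet := FiberBundle.mem_baseSet_trivializationAt' _
  have hnhds : L.ε ⁻¹' (L.triv x₀).baseSet ∈ 𝓝 x₀ :=
    ((L.triv x₀).open_baseSet.preimage L.contMDiff_ε.continuous).mem_nhds hmem
  rw [contMDiffAt_totalSpace]
  refine ⟨hb y₀, ?_⟩
  have hP : ContMDiffAt 𝓘(ℝ, EM) 𝓘(ℝ, EG →L[ℝ] EG) ∞ (L.projCoord x₀ x₀) x₀ := by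
    refine (L.contMDiffOn_projCoord x₀ x₀).contMDiffAt ?_
    rwa [inter_self]
  -- The `α`-representative of the class of `V` is `projα V`, so the normal coordinates are `frameC`
  -- of the projected coordinates.
  have hu := (L.frameC x₀).contDiff.contMDiff.contMDiffAt.comp y₀
    ((hP.comp y₀ (hb y₀)).clm_apply (contMDiffAt_totalSpace.1 (hV y₀)).2)
  refine hu.congr_of_eventuallyEq ?_
  filter_upwards [(hb y₀).continuousAt hnhds] with y hy
  have hy' : L.ε (b y) ∈ (L.triv x₀).baseSet := hy
  change L.frameC x₀ ((L.triv x₀).continuousLinearMapAt ℝ (L.ε (b y)) (L.projα (b y) (V y))) = _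
  rw [← L.projCoord_triv hy',
    Trivialization.continuousLinearMapAt_apply_of_mem (R := ℝ) (L.triv x₀) hy']
  rfl

end NormalBundle

end SmoothQuasiloopoid

/-! ### Derivatives within the fibres of a submersion. -/

section Fibres

variable {E E' M N : Type*} [NormedAddCommGroup E] [NormedSpace ℝ E]
  [NormedAddCommGroup E'] [NormedSpace ℝ E'] [TopologicalSpace M] [ChartedSpace E M]
  [TopologicalSpace N] [ChartedSpace E' N] {f : M → N}
  {E'' H'' P : Type*} [NormedAddCommGroup E''] [NormedSpace ℝ E''] [TopologicalSpace H'']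
  {I'' : ModelWithCorners ℝ E'' H''} [TopologicalSpace P] [ChartedSpace H'' P]

/-- On tangent vectors to the fibre, a derivative within the fibre is the derivative of the
composition with a local retraction. -/
theorem HasMFDerivWithinAt.apply_eq_mfderiv_retraction {U : Set (N × M)} {Q : N × M → M} {y : M}
    {c : N} (hU : IsOpen U) (hyU : (c, y) ∈ U)
    (hQ : ContMDiffOn (𝓘(ℝ, E').prod 𝓘(ℝ, E)) 𝓘(ℝ, E) ∞ Q U)
    (hfQ : ∀ p ∈ U, f (Q p) = p.1)
    (hQf : ∀ y, (f y, y) ∈ U → Q (f y, y) = y)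
    (hf : ContMDiff 𝓘(ℝ, E) 𝓘(ℝ, E') ∞ f) (hc : f y = c)
    {φ : M → P} {D : TangentSpace 𝓘(ℝ, E) y →L[ℝ] TangentSpace I'' (φ y)}
    (hD : HasMFDerivWithinAt 𝓘(ℝ, E) I'' φ {z | f z = c} y D)
    {v : TangentSpace 𝓘(ℝ, E) y} (hv : mfderiv 𝓘(ℝ, E) 𝓘(ℝ, E') f y v = 0) :
    D v = (mfderiv 𝓘(ℝ, E) I'' (fun z => φ (Q (c, z))) y v : E'') := by
  subst hc
  have hk : Q (f y, y) = y := hQf y hyU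
  let T : E →L[ℝ] E := mfderiv 𝓘(ℝ, E) 𝓘(ℝ, E) (fun z => Q (f y, z)) y
  have hTv : T v = v := mfderiv_retraction_apply hU hyU hQ hQf hf v hv
  have hO : {z | (f y, z) ∈ U} ∈ 𝓝 y :=
    (hU.preimage (Continuous.prodMk_right (f y))).mem_nhds hyU
  have hT : HasMFDerivAt 𝓘(ℝ, E) 𝓘(ℝ, E) (fun z => Q (f y, z)) y T := by
    refine MDifferentiableAt.hasMFDerivAt ?_
    exact ((hQ.contMDiffAt (hU.mem_nhds hyU)).mdifferentiableAt (by simp)).comp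
      (f := fun z => (f y, z)) y (mdifferentiableAt_const.prodMk mdifferentiableAt_id)
  let D' : E →L[ℝ] E'' := D
  have hD' : HasMFDerivWithinAt 𝓘(ℝ, E) I'' φ {z | f z = f y} (Q (f y, y)) D' := by
    rw [hk]; exact hD
  -- The retraction sends an open neighbourhood of `y` into the fibre, which turns a derivative
  -- within the fibre into an unrestricted one.
  have h1 : HasMFDerivWithinAt 𝓘(ℝ, E) I'' (fun z => φ (Q (f y, z))) {z | (f y, z) ∈ U} y
      (D'.comp T) :=
    HasMFDerivWithinAt.comp (f := fun z => Q (f y, z)) y hD' hT.hasMFDerivWithinAt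
      fun z hz => hfQ _ hz
  rw [(h1.hasMFDerivAt hO).mfderiv]
  change D' v = D' (T v)
  rw [hTv]

/-- Derivatives within a fibre of a submersion agree on the vectors tangent to the fibre. -/
theorem Manifold.IsSubmersion.hasMFDerivWithinAt_fibre_unique
    [IsManifold 𝓘(ℝ, E) ∞ M] [IsManifold 𝓘(ℝ, E') ∞ N]
    (hf : IsSubmersion 𝓘(ℝ, E) 𝓘(ℝ, E') ∞ f) {y : M} {c : N} (hc : f y = c) {φ : M → P}
    {D₁ D₂ : TangentSpace 𝓘(ℝ, E) y →L[ℝ] TangentSpace I'' (φ y)}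
    (h₁ : HasMFDerivWithinAt 𝓘(ℝ, E) I'' φ {z | f z = c} y D₁)
    (h₂ : HasMFDerivWithinAt 𝓘(ℝ, E) I'' φ {z | f z = c} y D₂)
    {v : TangentSpace 𝓘(ℝ, E) y} (hv : mfderiv 𝓘(ℝ, E) 𝓘(ℝ, E') f y v = 0) : D₁ v = D₂ v := by
  obtain ⟨U, Q, hU, hyU, hQ, hfQ, hQf⟩ := hf.exists_retraction y
  rw [hc] at hyU
  -- A fibre need not have unique derivatives in the ambient manifold, so both values are compared
  -- with one unrestricted derivative.
  exact (h₁.apply_eq_mfderiv_retraction hU hyU hQ hfQ hQf hf.contMDiff hc hv).trans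
    (h₂.apply_eq_mfderiv_retraction hU hyU hQ hfQ hQf hf.contMDiff hc hv).symm

end Fibres

/-- All tangent spaces are the model space by definition, so one `v` serves at both points. This
reconciles base points such as `β (ε x)` and `x`. -/
theorem tangentBundle_mk_congr {E M : Type*} [NormedAddCommGroup E] [NormedSpace ℝ E]
    [TopologicalSpace M] [ChartedSpace E M] {x y : M} (h : x = y) (v : E) :
    (⟨x, v⟩ : TangentBundle 𝓘(ℝ, E) M) = ⟨y, v⟩ := by
  subst h; rfl

/-! ### Left prolongations: projections to the units and smoothness. -/

namespace SmoothQuasiloopoid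

section Prolongation

variable {EG EM G M : Type*}
  [NormedAddCommGroup EG] [NormedSpace ℝ EG]
  [NormedAddCommGroup EM] [NormedSpace ℝ EM]
  [TopologicalSpace G] [ChartedSpace EG G]
  [TopologicalSpace M] [ChartedSpace EM M]
  (L : SmoothQuasiloopoid EG EM G M)

/-- Guarantees that the `mfderivWithin` in `leftProlongation` is a genuine derivative rather than
the default value `0`. -/
theorem hasMFDerivWithinAt_mul_left {g h : G} (hgh : L.α h = L.β g) :
    HasMFDerivWithinAt 𝓘(ℝ, EG) 𝓘(ℝ, EG) (fun h => L.mul g h) {h | L.α h = L.β g} h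
      (mfderivWithin 𝓘(ℝ, EG) 𝓘(ℝ, EG) (fun h => L.mul g h) {h | L.α h = L.β g} h) := by
  refine MDifferentiableWithinAt.hasMFDerivWithinAt ?_
  have h1 : ContMDiffOn 𝓘(ℝ, EG) 𝓘(ℝ, EG) ∞ (fun h => L.mul g h) {h | L.α h = L.β g} :=
    L.contMDiffOn_mul.comp (f := fun h => (g, h))
      (contMDiff_const.prodMk contMDiff_id).contMDiffOn fun z hz => Eq.symm hz
  exact (h1 h hgh).mdifferentiableWithinAt (by simp)

theorem hasMFDerivWithinAt_mul_left_unit (g : G) :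
    HasMFDerivWithinAt 𝓘(ℝ, EG) 𝓘(ℝ, EG) (fun h => L.mul g h) {h | L.α h = L.β g} (L.ε (L.β g))
      (mfderivWithin 𝓘(ℝ, EG) 𝓘(ℝ, EG) (fun h => L.mul g h) {h | L.α h = L.β g} (L.ε (L.β g))) :=
  L.hasMFDerivWithinAt_mul_left (L.α_ε _)

theorem leftProlongation_add (X Y : ∀ x, L.Normal x) :
    L.leftProlongation (X + Y) = L.leftProlongation X + L.leftProlongation Y := by
  ext1 g
  simp only [leftProlongation, Pi.add_apply, map_add]
  rfl

theorem leftProlongation_mul (f : M → ℝ) (X : ∀ x, L.Normal x) :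
    L.leftProlongation (fun x => f x • X x) = (f ∘ L.β) • L.leftProlongation X := by
  ext1 g
  simp only [leftProlongation, map_smul, Pi.smul_apply']
  rfl

variable [IsManifold 𝓘(ℝ, EG) ∞ G] [IsManifold 𝓘(ℝ, EM) ∞ M]

/-- Left translation by a unit is the identity on the fibre through it, and `repα` is tangent to
that fibre. -/
theorem leftProlongation_ε (X : ∀ x, L.Normal x) (x : M) :
    L.leftProlongation X (L.ε x) = L.repα x (X x) := by
  -- The fibre in the definition lies over `β (ε x)`, which equals `x` only propositionally; hence
  -- the auxiliary `y`.
  have key : ∀ y, y = x → (mfderivWithin 𝓘(ℝ, EG) 𝓘(ℝ, EG) (fun h => L.mul (L.ε x) h)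
      {h | L.α h = y} (L.ε y) (L.repα y (X y)) : EG) = L.repα x (X x) := by
    rintro y rfl
    have h1 := L.hasMFDerivWithinAt_mul_left (g := L.ε y) (h := L.ε y) (by rw [L.α_ε, L.β_ε])
    have h2 : HasMFDerivWithinAt 𝓘(ℝ, EG) 𝓘(ℝ, EG) (fun h => L.mul (L.ε y) h) {h | L.α h = y}
        (L.ε y) (ContinuousLinearMap.id ℝ EG) := by
      refine (hasMFDerivWithinAt_id _ (L.ε y)).congr_of_eventuallyEq ?_ ?_
      · filter_upwards [self_mem_nhdsWithin] with h hh
        rw [← show L.α h = y from hh]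
        exact L.unit_mul h
      · have := L.unit_mul (L.ε y)
        rwa [L.α_ε] at this
    simp only [L.β_ε] at h1
    exact L.isSubmersion_α.hasMFDerivWithinAt_fibre_unique (L.α_ε y) h1 h2 (L.Tα_repα y (X y))
  exact key _ (L.β_ε x)

/-- `α ∘ l_g` is constant on the fibre, so `0` is also a derivative of it there; fibrewise
uniqueness concludes. -/
theorem mfderiv_α_leftProlongation (hα : ∀ g h, L.α h = L.β g → L.α (L.mul g h) = L.α g)
    (X : ∀ x, L.Normal x) (g : G) :
    mfderiv 𝓘(ℝ, EG) 𝓘(ℝ, EM) L.α g (L.leftProlongation X g) = 0 := by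
  have h1 := L.hasMFDerivWithinAt_mul_left_unit g
  let T : EG →L[ℝ] EM := mfderiv 𝓘(ℝ, EG) 𝓘(ℝ, EM) L.α g
  have hT : HasMFDerivAt 𝓘(ℝ, EG) 𝓘(ℝ, EM) L.α (L.mul g (L.ε (L.β g))) T := by
    rw [L.mul_unit]
    exact (L.isSubmersion_α.contMDiff.mdifferentiable (by simp) g).hasMFDerivAt
  have h2 := hT.comp_hasMFDerivWithinAt (L.ε (L.β g)) h1
  have h3 : HasMFDerivWithinAt 𝓘(ℝ, EG) 𝓘(ℝ, EM) (L.α ∘ fun h => L.mul g h) {h | L.α h = L.β g}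
      (L.ε (L.β g)) (0 : EG →L[ℝ] EM) := by
    refine (hasMFDerivWithinAt_const (L.α g) _ (L.ε (L.β g))).congr_of_eventuallyEq ?_ ?_
    · filter_upwards [self_mem_nhdsWithin] with h hh using hα g h hh
    · exact hα g _ (L.α_ε _)
  exact L.isSubmersion_α.hasMFDerivWithinAt_fibre_unique (L.α_ε _) h2 h3 (L.Tα_repα _ (X (L.β g)))

/-- `β ∘ l_g = β` on the fibre, so `T l_g` does not change the image of `X̄^α` under `Tβ`. -/
theorem mfderiv_β_leftProlongation (hβ : ∀ g h, L.α h = L.β g → L.β (L.mul g h) = L.β h)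
    (X : ∀ x, L.Normal x) (g : G) :
    mfderiv 𝓘(ℝ, EG) 𝓘(ℝ, EM) L.β g (L.leftProlongation X g) =
      L.leftAnchor (L.β g) (X (L.β g)) := by
  have h1 := L.hasMFDerivWithinAt_mul_left_unit g
  have hd := L.isSubmersion_β.contMDiff.mdifferentiable (n := ∞) (by simp)
  let T : EG →L[ℝ] EM := mfderiv 𝓘(ℝ, EG) 𝓘(ℝ, EM) L.β g
  have hT : HasMFDerivAt 𝓘(ℝ, EG) 𝓘(ℝ, EM) L.β (L.mul g (L.ε (L.β g))) T := by
    rw [L.mul_unit]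
    exact (hd g).hasMFDerivAt
  have h2 := hT.comp_hasMFDerivWithinAt (L.ε (L.β g)) h1
  have h3 : HasMFDerivWithinAt 𝓘(ℝ, EG) 𝓘(ℝ, EM) (L.β ∘ fun h => L.mul g h) {h | L.α h = L.β g}
      (L.ε (L.β g)) (mfderiv 𝓘(ℝ, EG) 𝓘(ℝ, EM) L.β (L.ε (L.β g)) : EG →L[ℝ] EM) := by
    refine (hd (L.ε (L.β g))).hasMFDerivAt.hasMFDerivWithinAt.congr_of_eventuallyEq ?_ ?_
    · filter_upwards [self_mem_nhdsWithin] with h hh using hβ g h hh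
    · exact hβ g _ (L.α_ε _)
  exact L.isSubmersion_α.hasMFDerivWithinAt_fibre_unique (L.α_ε _) h2 h3 (L.Tα_repα _ (X (L.β g)))

theorem contMDiff_leftProlongation [FiniteDimensional ℝ EG] {X : ∀ x, L.Normal x}
    (hX : IsSmoothSection EM (NormalModel EG EM) X) :
    ContMDiff 𝓘(ℝ, EG) 𝓘(ℝ, EG).tangent ∞
      (fun g => (⟨g, L.leftProlongation X g⟩ : TangentBundle 𝓘(ℝ, EG) G)) := by
  intro g₀
  have hβ : ContMDiff 𝓘(ℝ, EG) 𝓘(ℝ, EM) ∞ L.β := L.isSubmersion_β.contMDiff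
  obtain ⟨U, Q, hU, hgU, hQ, hαQ, hQα⟩ := L.isSubmersion_α.exists_retraction (L.ε (L.β g₀))
  rw [L.α_ε] at hgU
  -- `F (g, ·)` extends `l_g` off the fibre over `β g`, so the prolongation is the partial
  -- derivative of `F` in its second variable applied to `X̄^α`.
  let F : G × G → G := fun p => L.mul p.1 (Q (L.β p.1, p.2))
  let W : Set (G × G) := {p | (L.β p.1, p.2) ∈ U}
  have hc : ContMDiff (𝓘(ℝ, EG).prod 𝓘(ℝ, EG)) (𝓘(ℝ, EM).prod 𝓘(ℝ, EG)) ∞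
      (fun p : G × G => (L.β p.1, p.2)) := (hβ.comp contMDiff_fst).prodMk contMDiff_snd
  have hW : IsOpen W := hU.preimage hc.continuous
  have hF : ContMDiffOn (𝓘(ℝ, EG).prod 𝓘(ℝ, EG)) 𝓘(ℝ, EG) ∞ F W :=
    L.contMDiffOn_mul.comp (f := fun p : G × G => (p.1, Q (L.β p.1, p.2)))
      (contMDiffOn_fst.prodMk (hQ.comp hc.contMDiffOn fun p hp => hp))
      fun p hp => (hαQ _ hp).symm
  have hV : ContMDiff 𝓘(ℝ, EG) 𝓘(ℝ, EG).tangent ∞ (fun g =>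
      (⟨L.ε (L.β g), L.repα (L.β g) (X (L.β g))⟩ : TangentBundle 𝓘(ℝ, EG) G)) :=
    L.contMDiff_repα.comp (hX.comp hβ)
  have h0 : ContMDiff 𝓘(ℝ, EG) 𝓘(ℝ, EG).tangent ∞
      (fun g => (⟨g, 0⟩ : TangentBundle 𝓘(ℝ, EG) G)) := contMDiff_zeroSection _ _
  -- The smooth field `(0, X̄^α)` along `g ↦ (g, ε (β g))`, to be pushed forward by the tangent map
  -- of `F`.
  have hS := (contMDiff_equivTangentBundleProd_symm (I := 𝓘(ℝ, EG)) (M := G) (I' := 𝓘(ℝ, EG))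
    (M' := G) (n := ∞)).comp (h0.prodMk hV)
  have hT := hF.contMDiffOn_tangentMapWithin (m := ∞) (by simp) hW.uniqueMDiffOn
  have hWg : (g₀, L.ε (L.β g₀)) ∈ W := hgU
  have hcomp := (hT.contMDiffAt ((hW.preimage
    (FiberBundle.continuous_proj (EG × EG) (TangentSpace (𝓘(ℝ, EG).prod 𝓘(ℝ, EG))))).mem_nhds
    hWg)).comp g₀ (hS g₀)
  refine hcomp.congr_of_eventuallyEq ?_
  have hev : ∀ᶠ g in 𝓝 g₀, (g, L.ε (L.β g)) ∈ W :=
    (continuous_id.prodMk (L.contMDiff_ε.continuous.comp hβ.continuous)).continuousAt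
      (hW.mem_nhds hWg)
  filter_upwards [hev] with g hg
  have hQg : Q (L.β g, L.ε (L.β g)) = L.ε (L.β g) := by
    have := hQα (L.ε (L.β g))
    rw [L.α_ε] at this
    exact this hg
  have hFg : F (g, L.ε (L.β g)) = g := by
    change L.mul g (Q (L.β g, L.ε (L.β g))) = g
    rw [hQg, L.mul_unit]
  let D : EG × EG →L[ℝ] EG := mfderivWithin (𝓘(ℝ, EG).prod 𝓘(ℝ, EG)) 𝓘(ℝ, EG) F W
    (g, L.ε (L.β g))
  have hD : HasMFDerivAt (𝓘(ℝ, EG).prod 𝓘(ℝ, EG)) 𝓘(ℝ, EG) F (g, L.ε (L.β g)) D :=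
    ((hF _ hg).mdifferentiableWithinAt (by simp)).hasMFDerivWithinAt.hasMFDerivAt
      (hW.mem_nhds hg)
  have h2 : HasMFDerivAt 𝓘(ℝ, EG) 𝓘(ℝ, EG) (fun h => F (g, h)) (L.ε (L.β g))
      (D.comp ((0 : EG →L[ℝ] EG).prod (ContinuousLinearMap.id ℝ EG))) :=
    HasMFDerivAt.comp (f := fun h => (g, h)) (L.ε (L.β g)) hD
      ((hasMFDerivAt_const g (L.ε (L.β g))).prodMk (hasMFDerivAt_id (L.ε (L.β g))))
  have h3 := (L.hasMFDerivWithinAt_mul_left_unit g).apply_eq_mfderiv_retraction hU hg hQ hαQ hQα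
    L.isSubmersion_α.contMDiff (L.α_ε _) (L.Tα_repα _ (X (L.β g)))
  have h4 : (L.leftProlongation X g : EG) = D (0, L.repα (L.β g) (X (L.β g))) :=
    h3.trans (DFunLike.congr_fun h2.mfderiv (L.repα (L.β g) (X (L.β g))))
  refine Eq.trans ?_ (tangentBundle_mk_congr hFg (D (0, L.repα (L.β g) (X (L.β g))))).symm
  exact congrArg (fun v : EG => (⟨g, v⟩ : TangentBundle 𝓘(ℝ, EG) G)) h4

end Prolongation

end SmoothQuasiloopoid

/-! ### The left almost Lie algebroid. -/

namespace SmoothQuasiloopoid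

section Algebroid

variable {EG EM G M : Type*}
  [NormedAddCommGroup EG] [NormedSpace ℝ EG] [FiniteDimensional ℝ EG]
  [NormedAddCommGroup EM] [NormedSpace ℝ EM] [FiniteDimensional ℝ EM]
  [TopologicalSpace G] [ChartedSpace EG G] [IsManifold 𝓘(ℝ, EG) ∞ G]
  [TopologicalSpace M] [ChartedSpace EM M] [IsManifold 𝓘(ℝ, EM) ∞ M]
  (L : SmoothQuasiloopoid EG EM G M)

omit [FiniteDimensional ℝ EM] in
theorem contMDiff_leftAnchor : ContMDiff (𝓘(ℝ, EM).prod 𝓘(ℝ, NormalModel EG EM)) 𝓘(ℝ, EM).tangent ∞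
    (fun p : TotalSpace (NormalModel EG EM) L.Normal =>
      (⟨p.1, L.leftAnchor p.1 p.2⟩ : TangentBundle 𝓘(ℝ, EM) M)) := by
  have h := (L.isSubmersion_β.contMDiff.contMDiff_tangentMap (m := ∞) (by simp)).comp
    L.contMDiff_repα
  convert h using 1
  ext1 p
  exact (tangentBundle_mk_congr (E := EM) (L.β_ε p.1) (L.leftAnchor p.1 p.2)).symm

omit [FiniteDimensional ℝ EM] in
theorem contMDiff_mlieBracket_leftProlongation {X Y : ∀ x, L.Normal x}
    (hX : IsSmoothSection EM (NormalModel EG EM) X)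
    (hY : IsSmoothSection EM (NormalModel EG EM) Y) :
    ContMDiff 𝓘(ℝ, EG) 𝓘(ℝ, EG).tangent ∞
      (fun g => (⟨g, mlieBracket 𝓘(ℝ, EG) (L.leftProlongation X) (L.leftProlongation Y) g⟩ :
        TangentBundle 𝓘(ℝ, EG) G)) := by
  have : IsManifold 𝓘(ℝ, EG) (((⊤ : ℕ∞) : WithTop ℕ∞) + 1) G :=
    inferInstanceAs (IsManifold 𝓘(ℝ, EG) ∞ G)
  have : IsManifold 𝓘(ℝ, EG) 2 G := IsManifold.of_le (n := ∞) two_le_infty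
  have : IsManifold 𝓘(ℝ, EG) (minSmoothness ℝ 2) G := by simpa
  have : CompleteSpace EG := FiniteDimensional.complete ℝ EG
  exact ContDiff.mlieBracket_vectorField (m := ⊤) (n := ⊤) (L.contMDiff_leftProlongation hX)
    (L.contMDiff_leftProlongation hY) (by simp)

/-- The normal bundle of a quasiloopoid whose product is compatible with `α` and `β` is an almost
Lie algebroid for the left bracket. -/
theorem isAlmostLieAlgebroid_left
    (hα : ∀ g h, L.α h = L.β g → L.α (L.mul g h) = L.α g)
    (hβ : ∀ g h, L.α h = L.β g → L.β (L.mul g h) = L.β h) :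
    IsAlmostLieAlgebroid (NormalModel EG EM) L.leftBracket L.leftAnchor := by
  have hd : ∀ {X : ∀ x, L.Normal x}, IsSmoothSection EM (NormalModel EG EM) X → ∀ g : G,
      MDifferentiableAt 𝓘(ℝ, EG) 𝓘(ℝ, EG).tangent
        (fun g => (⟨g, L.leftProlongation X g⟩ : TangentBundle 𝓘(ℝ, EG) G)) g :=
    fun hX g => (L.contMDiff_leftProlongation hX).mdifferentiable (by simp) g
  have : CompleteSpace EG := FiniteDimensional.complete ℝ EG
  have : CompleteSpace EM := FiniteDimensional.complete ℝ EM
  have : IsManifold 𝓘(ℝ, EG) 2 G := IsManifold.of_le (n := ∞) two_le_infty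
  have : IsManifold 𝓘(ℝ, EG) (minSmoothness ℝ 2) G := by simpa
  refine ⟨⟨?_, ?_, ?_, ?_, L.contMDiff_leftAnchor, ?_⟩, ?_⟩
  · intro X Y hX hY
    exact L.contMDiff_normalMk contMDiff_id
      ((L.contMDiff_mlieBracket_leftProlongation hX hY).comp L.contMDiff_ε)
  · intro X Y _ _
    ext1 x
    rw [leftBracket, mlieBracket_swap_apply, map_neg]
    rfl
  · intro X X' Y hX hX' hY
    ext1 x
    rw [leftBracket, leftProlongation_add, mlieBracket_add_left (hd hX _) (hd hX' _), map_add]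
    rfl
  · intro c X Y hX hY
    ext1 x
    have : L.leftProlongation (c • X) = c • L.leftProlongation X :=
      L.leftProlongation_mul (fun _ => c) X
    rw [leftBracket, this, mlieBracket_const_smul_left (hd hX _), map_smul]
    rfl
  · intro f X Y hf hX hY x
    have hfβ : MDifferentiableAt 𝓘(ℝ, EG) 𝓘(ℝ, ℝ) (f ∘ L.β) (L.ε x) :=
      (hf.comp L.isSubmersion_β.contMDiff).mdifferentiable (by simp) _
    let T : EM →L[ℝ] ℝ := mfderiv 𝓘(ℝ, EM) 𝓘(ℝ, ℝ) f x
    have hT : HasMFDerivAt 𝓘(ℝ, EM) 𝓘(ℝ, ℝ) f (L.β (L.ε x)) T := by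
      rw [L.β_ε]
      exact (hf.mdifferentiable (by simp) x).hasMFDerivAt
    have hder : mfderiv 𝓘(ℝ, EG) 𝓘(ℝ, ℝ) (f ∘ L.β) (L.ε x) = T.comp (L.Tβ x) :=
      (HasMFDerivAt.comp (L.ε x) hT
        (L.isSubmersion_β.contMDiff.mdifferentiable (by simp) (L.ε x)).hasMFDerivAt).mfderiv
    -- The prolongation of `X` at a unit is `X̄^α`, so it differentiates `f ∘ β` as the anchor of
    -- `X` differentiates `f`.
    have hd' : mvfderiv 𝓘(ℝ, EG) (f ∘ L.β) (L.ε x) (L.leftProlongation X (L.ε x)) =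
        NormedSpace.fromTangentSpace (𝕜 := ℝ) (f x)
          (mfderiv 𝓘(ℝ, EM) 𝓘(ℝ, ℝ) f x (L.leftAnchor x (X x))) := by
      rw [leftProlongation_ε]
      exact DFunLike.congr_fun hder (L.repα x (X x))
    rw [leftBracket, leftProlongation_mul, mlieBracket_smul_right hfβ (hd hY _), hd', map_add,
      map_smul, map_smul, leftProlongation_ε, normalMk_repα, Function.comp_apply, L.β_ε, add_comm]
    rfl
  · intro X Y hX hY x
    have hsm : ∀ {X : ∀ x, L.Normal x}, IsSmoothSection EM (NormalModel EG EM) X → ∀ y : M,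
        MDifferentiableAt 𝓘(ℝ, EM) 𝓘(ℝ, EM).tangent
          (fun y => (⟨y, L.leftAnchor y (X y)⟩ : TangentBundle 𝓘(ℝ, EM) M)) y :=
      fun hX y => (L.contMDiff_leftAnchor.comp hX).mdifferentiable (by simp) y
    have h0 : ∀ y : M, MDifferentiableAt 𝓘(ℝ, EM) 𝓘(ℝ, EM).tangent
          (fun y => (⟨y, (0 : ∀ y : M, TangentSpace 𝓘(ℝ, EM) y) y⟩ : TangentBundle 𝓘(ℝ, EM) M)) y :=
      fun y => (contMDiff_zeroSection (n := ∞) _ _).mdifferentiable (by simp) y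
    let B := mlieBracket 𝓘(ℝ, EG) (L.leftProlongation X) (L.leftProlongation Y) (L.ε x)
    -- Both prolongations are `α`-related to the zero field, hence so is their bracket.
    have hB : L.Tα x B = 0 := by
      have := mfderiv_mlieBracket_of_related L.isSubmersion_α.contMDiff (hd hX (L.ε x))
        (hd hY (L.ε x)) (h0 _) (h0 _) (L.mfderiv_α_leftProlongation hα X)
        (L.mfderiv_α_leftProlongation hα Y)
      rw [mlieBracket_zero_left] at this
      exact this
    -- Being tangent to the `α`-fibre, the bracket is recovered from its normal class without loss.
    have hrep : L.repα x (L.leftBracket X Y x) = B := by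
      change L.projα x B = B
      change B - L.Tε x (L.Tα x B) = B
      rw [hB, map_zero, sub_zero]
    change L.Tβ x (L.repα x (L.leftBracket X Y x)) = _
    rw [hrep]
    have h1 := mfderiv_mlieBracket_of_related L.isSubmersion_β.contMDiff (hd hX (L.ε x))
      (hd hY (L.ε x)) (hsm hX _) (hsm hY _) (L.mfderiv_β_leftProlongation hβ X)
      (L.mfderiv_β_leftProlongation hβ Y)
    refine h1.trans ?_
    let Z : M → EM := mlieBracket 𝓘(ℝ, EM) (fun y => L.leftAnchor y (X y))
      (fun y => L.leftAnchor y (Y y))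
    exact congrArg Z (L.β_ε x)

end Algebroid

/-! ### The opposite quasiloopoid and the right algebroid. -/

section Opposite

variable {EG EM G M : Type*}
  [NormedAddCommGroup EG] [NormedSpace ℝ EG]
  [NormedAddCommGroup EM] [NormedSpace ℝ EM]
  [TopologicalSpace G] [ChartedSpace EG G]
  [TopologicalSpace M] [ChartedSpace EM M]
  (L : SmoothQuasiloopoid EG EM G M)

/-- The opposite quasiloopoid, with source and target exchanged. -/
def op : SmoothQuasiloopoid EG EM G M where
  α := L.β
  β := L.α
  ε := L.ε
  mul g h := L.mul h g
  isSubmersion_α := L.isSubmersion_β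
  isSubmersion_β := L.isSubmersion_α
  surjective_α := L.surjective_β
  surjective_β := L.surjective_α
  isSmoothEmbedding_ε := L.isSmoothEmbedding_ε
  α_ε := L.β_ε
  β_ε := L.α_ε
  mul_unit := L.unit_mul
  unit_mul := L.mul_unit
  contMDiffOn_mul := L.contMDiffOn_mul.comp (contMDiff_snd.prodMk contMDiff_fst).contMDiffOn
    fun _ hp => Eq.symm hp
  injOn_left := L.injOn_right
  injOn_right := L.injOn_left
  immersion_left g h := L.immersion_right h g
  immersion_right g h := L.immersion_left h g

/-- `Tε` is a section of both `Tα` and `Tβ`, so on the class of `v` the right anchor is `Tα v - Tβ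
v` and the left one `Tβ v - Tα v`. -/
theorem rightAnchor_eq_neg_leftAnchor (x : M) : L.rightAnchor x = -L.leftAnchor x := by
  ext a
  obtain ⟨v, rfl⟩ := (L.Tε x).range.mkQ_surjective a
  change L.Tα x (v - L.Tε x (L.Tβ x v)) = -L.Tβ x (v - L.Tε x (L.Tα x v))
  rw [map_sub, map_sub, Tα_Tε, Tβ_Tε, neg_sub]

variable [FiniteDimensional ℝ EG] [IsManifold 𝓘(ℝ, EG) ∞ G] [IsManifold 𝓘(ℝ, EM) ∞ M]

/-- The normal bundles of a quasiloopoid and of its opposite have the same smooth structure. -/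
theorem contMDiff_toOp :
    ContMDiff (𝓘(ℝ, EM).prod 𝓘(ℝ, NormalModel EG EM)) (𝓘(ℝ, EM).prod 𝓘(ℝ, NormalModel EG EM)) ∞
      (fun p : TotalSpace (NormalModel EG EM) L.Normal =>
        (⟨p.1, p.2⟩ : TotalSpace (NormalModel EG EM) L.op.Normal)) := by
  -- The fibres agree, but the trivializations use `repα` for one bundle and `repβ` for the other.
  -- The identity factors through `TG`: take the `α`-representative, then its class.
  have h := L.op.contMDiff_normalMk (contMDiff_proj L.Normal) L.contMDiff_repα
  convert h using 1
  ext1 p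
  exact congrArg (TotalSpace.mk p.1) (L.normalMk_repα p.1 p.2).symm

theorem IsSmoothSection.toOp {X : ∀ x, L.Normal x}
    (hX : IsSmoothSection EM (NormalModel EG EM) X) :
    IsSmoothSection EM (NormalModel EG EM) (A := L.op.Normal) X :=
  L.contMDiff_toOp.comp hX

/-- `L.op.op` is `L` by definition, so the comparison for `L.op` gives the converse. -/
theorem IsSmoothSection.ofOp {X : ∀ x, L.Normal x}
    (hX : IsSmoothSection EM (NormalModel EG EM) (A := L.op.Normal) X) :
    IsSmoothSection EM (NormalModel EG EM) X :=
  L.op.contMDiff_toOp.comp hX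

/-- The normal bundle of a quasiloopoid whose product is compatible with `α` and `β` is an almost
Lie algebroid for the right bracket. -/
theorem isAlmostLieAlgebroid_right [FiniteDimensional ℝ EM]
    (hα : ∀ g h, L.α h = L.β g → L.α (L.mul g h) = L.α g)
    (hβ : ∀ g h, L.α h = L.β g → L.β (L.mul g h) = L.β h) :
    IsAlmostLieAlgebroid (NormalModel EG EM) L.rightBracket L.rightAnchor := by
  -- The right bracket and anchor are by definition the left ones of `L.op`; the roles of `hα` and
  -- `hβ` are exchanged.
  have h := L.op.isAlmostLieAlgebroid_left (fun g h hgh => hβ h g hgh.symm)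
    (fun g h hgh => hα h g hgh.symm)
  exact
    { smooth_bracket := fun X Y hX hY => IsSmoothSection.ofOp L
        (h.smooth_bracket X Y (IsSmoothSection.toOp L hX) (IsSmoothSection.toOp L hY))
      skew := fun X Y hX hY =>
        h.skew X Y (IsSmoothSection.toOp L hX) (IsSmoothSection.toOp L hY)
      add_left := fun X X' Y hX hX' hY => h.add_left X X' Y (IsSmoothSection.toOp L hX)
        (IsSmoothSection.toOp L hX') (IsSmoothSection.toOp L hY)
      smul_left := fun c X Y hX hY =>
        h.smul_left c X Y (IsSmoothSection.toOp L hX) (IsSmoothSection.toOp L hY)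
      smooth_anchor := h.smooth_anchor.comp L.contMDiff_toOp
      leibniz := fun f X Y hf hX hY =>
        h.leibniz f X Y hf (IsSmoothSection.toOp L hX) (IsSmoothSection.toOp L hY)
      anchor_bracket := fun X Y hX hY =>
        h.anchor_bracket X Y (IsSmoothSection.toOp L hX) (IsSmoothSection.toOp L hY) }

end Opposite

end SmoothQuasiloopoid

/-! ### The theorem for loopoids. -/

theorem mainTheorem3 {EG EM G M : Type*}
    [NormedAddCommGroup EG] [NormedSpace ℝ EG] [FiniteDimensional ℝ EG]
    [NormedAddCommGroup EM] [NormedSpace ℝ EM] [FiniteDimensional ℝ EM]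
    [TopologicalSpace G] [ChartedSpace EG G] [IsManifold 𝓘(ℝ, EG) ∞ G]
    [T2Space G] [SecondCountableTopology G]
    [TopologicalSpace M] [ChartedSpace EM M] [IsManifold 𝓘(ℝ, EM) ∞ M]
    (L : SmoothQuasiloopoid EG EM G M) (hL : L.IsLoopoid) :
    (∀ X : ∀ x, L.Normal x, IsSmoothSection EM (NormalModel EG EM) X →
      ContMDiff 𝓘(ℝ, EG) 𝓘(ℝ, EG).tangent ∞
        (fun g => (⟨g, L.leftProlongation X g⟩ : TangentBundle 𝓘(ℝ, EG) G)) ∧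
      ContMDiff 𝓘(ℝ, EG) 𝓘(ℝ, EG).tangent ∞
        (fun g => (⟨g, L.rightProlongation X g⟩ : TangentBundle 𝓘(ℝ, EG) G))) ∧
    IsAlmostLieAlgebroid (NormalModel EG EM) L.leftBracket L.leftAnchor ∧
    IsAlmostLieAlgebroid (NormalModel EG EM) L.rightBracket L.rightAnchor ∧
    ∀ x, L.rightAnchor x = -L.leftAnchor x := by

  -- Left translation by `g` takes values in `α⁻¹(α g)`; `hβ` is the analogue for right
  -- translations.
  have hα : ∀ g h, L.α h = L.β g → L.α (L.mul g h) = L.α g := fun g h hgh => by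
    obtain ⟨_, hk, _⟩ := hL.left_diffeo g
    exact hk hgh
  have hβ : ∀ g h, L.α h = L.β g → L.β (L.mul g h) = L.β h := fun g h hgh => by
    obtain ⟨_, hk, _⟩ := hL.right_diffeo h
    exact hk hgh.symm
  exact ⟨fun X hX => ⟨L.contMDiff_leftProlongation hX,
      L.op.contMDiff_leftProlongation (SmoothQuasiloopoid.IsSmoothSection.toOp L hX)⟩,
    L.isAlmostLieAlgebroid_left hα hβ, L.isAlmostLieAlgebroid_right hα hβ,
    L.rightAnchor_eq_neg_leftAnchor⟩
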